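/- Let $n,q$ be integers with $1\le q\le n$, and put $a=n+1-q$. For $\Re(s)>n$ set $$\overline{\zeta}_q(s)=\sum_{k\ge q}\frac{d_{n,q}(k)}{\bigl(k(k+a)\bigr)^s},\qquad d_{n,q}(k)=\Bigl(\frac1k+\frac1{k+a}\Bigr)\frac{(k+n)!\,(k+n-q)!}{k!\,(k-q)!\,n!\,(n-q)!\,(q-1)!},$$ and let $\zeta_q=\overline{\zeta}_q+\overline{\zeta}_{q+1}$ if $q<n$ and $\zeta_n=\overline{\zeta}_n$. (This is the known expression, taken here as the definition, of the zeta function of the Laplacian on $(0,q)$-forms of $\mathbb{P}^n(\mathbb{C})$ with the Fubini–Study metric.) For $k\ge q$ let $$\alpha_{n,q}(k)=\frac{n!}{(q-1)!\,(n-q)!}\,\frac{\binom{k+n}{k}\binom{k-q+n}{k-q}}{k(k+a)},\qquad S_{n,q}(z)=\sum_{k\ge q}\alpha_{n,q}(k)z^k\quad(|z|<1),$$ and for $\Re(s)>2n-1$ let $$\xi_q(s)=\frac1{\Gamma(s)}\int_0^\infty t^{s-1}S_{n,q}(e^{-t})e^{-at}\,dt .$$ Let $c_{n,q,k}$ be the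 coefficient of $z^k$ in $(1-z)^{2n-1}S_{n,q}(z)$, define $b_{2n-1,i}$ by $\binom{z+2n-2}{2n-2}=\sum_{i=0}^{2n-2}b_{2n-1,i}z^i$, let $B_r(\cdot)$ be the Bernoulli polynomials, and set $$\beta_{n,q}(l,i,p)=\sum_{k=q}^{2n-1}c_{n,q,k}(-k-a)^{i-p}B_{l+p+1}(k+a)\quad(l\ge 0,\ 0\le p\le i\le 2n-2),$$ $$\gamma_{n,q}(l)=\sum_{k=q}^{2n-1}c_{n,q,k}\sum_{i=l-1}^{2n-2}b_{2n-1,i}\binom{i}{l-1}(-k-a)^{i-l+1}\quad(1\le l\le 2n-1).$$ **Theorem.** The series for $\overline{\zeta}_q(s)$ converges absolutely for $\Re(s)>n$, the series $S_{n,q}(z)$ for $|z|<1$ and the integral for $\xi_q(s)$ for $\Re(s)>2n-1$, and $\xi_q$, $\overline{\zeta}_q$, $\zeta_q$ extend meromorphically to $\mathbb{C}$. The extension of $\xi_q$ is holomorphic outside $\{1,\dots,2n-1\}$; at $l\in\{1,\dots,2n-1\}$ it has at most a simple pole, with residue $\gamma_{n,q}(l)$; and for every integer $l\ge 0$ $$\xi_q(-l)=-\sum_{i=0}^{2n-2}b_{2n-1,i}\sum_{p=0}^{i}\binom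 ip\frac{\beta_{n,q}(l,i,p)}{p+l+1}.$$ For every integer $m\ge 0$ the functions $\overline{\zeta}_q$ and $\zeta_q$ are holomorphic at $-m$, $$\begin{aligned}\overline{\zeta}_q(-m)={}&\sum_{j=0}^{2m+1}(-1)^j\,\frac{2m+2-j}{m+1}\binom{m+1}{j}a^j\,\xi_q(-2m+j-1)\\&+\frac{(-1)^m\,m!}{2}\sum_{j=2m+2}^{2n+2m}a^j\,\frac{\Gamma(-m+j-1)\,(-2m-2+j)}{\Gamma(j+1)}\,\gamma_{n,q}(-2m+j-1),\end{aligned}$$ and in particular $\overline{\zeta}_q(-m)\in\mathbb{Q}$ and $\zeta_q(-m)\in\mathbb{Q}$. -/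

import Mathlib

open Filter Topology

namespace FubiniStudyZeta

/-- The coefficients
`d_{n,q}(k) = (1/k + 1/(k+n+1-q)) (k+n)! (k+n-q)! / (k! (k-q)! n! (n-q)! (q-1)!)`,
used for `1 ≤ q ≤ n` and `k ≥ q` only. -/
def d (n q k : ℕ) : ℚ :=
  (1 / (k : ℚ) + 1 / ((k + n + 1 - q : ℕ) : ℚ)) *
    (((k + n).factorial : ℚ) * (k + n - q).factorial) /
      ((k.factorial : ℚ) * (k - q).factorial * n.factorial * (n - q).factorial *
        (q - 1).factorial)

/-- The `k`-th term of the Dirichlet series `∑_{k ≥ q} d_{n,q}(k) / (k (k+n+1-q))^s`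
(zero for `k < q`). -/
noncomputable def zetaBarTerm (n q : ℕ) (s : ℂ) (k : ℕ) : ℂ :=
  if q ≤ k then (d n q k : ℂ) / ((k * (k + n + 1 - q) : ℕ) : ℂ) ^ s else 0

/-- `∑_{k ≥ q} d_{n,q}(k) / (k (k+n+1-q))^s`, meaningful for `Re s > n`. -/
noncomputable def zetaBarSeries (n q : ℕ) (s : ℂ) : ℂ :=
  ∑' k : ℕ, zetaBarTerm n q s k

/-- The Dirichlet series of the non-zero spectrum of the Laplacian on `(0,q)`-forms of projective
`n`-space, `1 ≤ q ≤ n`: the sum of the series for `q` and for `q + 1` if `q < n`, and the series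
for `n` if `q = n`. Meaningful for `Re s > n`. -/
noncomputable def zetaSeries (n q : ℕ) (s : ℂ) : ℂ :=
  if q < n then zetaBarSeries n q s + zetaBarSeries n (q + 1) s else zetaBarSeries n q s

/-- `F` is the meromorphic continuation to `ℂ` of the function `f`, given on `Re s > σ`.
Normal form fixes the value of `F` at each removable singularity as the limit
(and as `0` at each pole), so `F` is unique. -/
def IsMeromorphicContinuation (σ : ℝ) (f F : ℂ → ℂ) : Prop :=
  MeromorphicNFOn F Set.univ ∧ ∀ s : ℂ, σ < s.re → F s = f s

/-- The coefficients
`α_{n,q}(k) = n! / ((q-1)! (n-q)!) * C(k+n,k) C(k-q+n,k-q) / (k (k+n+1-q))` for `k ≥ q`,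
and `0` for `k < q`. -/
def α (n q k : ℕ) : ℚ :=
  if q ≤ k then
    (n.factorial : ℚ) / (((q - 1).factorial : ℚ) * (n - q).factorial) *
      (((k + n).choose k : ℚ) * (k - q + n).choose (k - q)) /
        ((k : ℚ) * ((k + n + 1 - q : ℕ) : ℚ))
  else 0

/-- `S_{n,q}(z) = ∑_{k ≥ q} α_{n,q}(k) z^k`, meaningful for `|z| < 1`. -/
noncomputable def S (n q : ℕ) (z : ℂ) : ℂ :=
  ∑' k : ℕ, (α n q k : ℂ) * z ^ k

/-- The function `t ↦ S_{n,q}(e^{-t}) e^{-(n+1-q)t}` on `t > 0`. -/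
noncomputable def xiKernel (n q : ℕ) (t : ℝ) : ℂ :=
  S n q (Complex.exp (-(t : ℂ))) * Complex.exp (-((n : ℂ) + 1 - q) * t)

/-- `1/Γ(s) ∫_0^∞ t^{s-1} S_{n,q}(e^{-t}) e^{-(n+1-q)t} dt`, meaningful for `Re s > 2n-1`. -/
noncomputable def xiIntegral (n q : ℕ) (s : ℂ) : ℂ :=
  1 / Complex.Gamma s * mellin (xiKernel n q) s

/-- `c_{n,q,k}`: the coefficient of `z^k` in `(1-z)^{2n-1} S_{n,q}(z)`. -/
noncomputable def c (n q k : ℕ) : ℚ :=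
  PowerSeries.coeff k ((1 - PowerSeries.X) ^ (2 * n - 1) * PowerSeries.mk (α n q))

/-- `b_{2n-1,i}`: the coefficient of `z^i` in
`C(z+2n-2, 2n-2) = (z+1)(z+2)⋯(z+2n-2) / (2n-2)!`. -/
noncomputable def b (n i : ℕ) : ℚ :=
  (Polynomial.C (1 / ((2 * n - 2).factorial : ℚ)) *
    ∏ r ∈ Finset.Icc 1 (2 * n - 2), (Polynomial.X + Polynomial.C (r : ℚ))).coeff i

/-- `β_{n,q}(l,i,p) = ∑_{k=q}^{2n-1} c_{n,q,k} (q-n-1-k)^{i-p} B_{l+p+1}(k+n+1-q)`,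
with `B_r` the Bernoulli polynomials, used for `p ≤ i`. -/
noncomputable def β (n q l i p : ℕ) : ℚ :=
  ∑ k ∈ Finset.Icc q (2 * n - 1),
    c n q k * ((q : ℚ) - n - 1 - k) ^ (i - p) *
      (Polynomial.bernoulli (l + p + 1)).eval ((k : ℚ) + n + 1 - q)

/-- `γ_{n,q}(l) = ∑_{k=q}^{2n-1} c_{n,q,k} ∑_{i=l-1}^{2n-2} b_{2n-1,i} C(i,l-1) (q-n-1-k)^{i-l+1}`,
used for `1 ≤ l ≤ 2n-1`. -/
noncomputable def γ (n q l : ℕ) : ℚ :=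
  ∑ k ∈ Finset.Icc q (2 * n - 1), c n q k *
    ∑ i ∈ Finset.Icc (l - 1) (2 * n - 2),
      b n i * (i.choose (l - 1) : ℚ) * ((q : ℚ) - n - 1 - k) ^ (i - (l - 1))

end FubiniStudyZeta

namespace FubiniStudyZeta

/-! Write a = n+1-q and x = k+a. On the positive integers α is a polynomial of degree at most 2n-2,
so (1-z)^(2n-1) S(z) is a polynomial, and each α(N) is a finite combination, with coefficients built
from `c` and `b`, of powers of N+a. Termwise Mellin integration turns ξ into ∑ α(N) (N+a)^(-s)
(`hasSum_mellin_xiKernel`). Hence ξ is a finite combination `xiCont` of translated, truncated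
Riemann zeta functions (`hasSum_xiCont`). The pole of ζ at 1 gives the residues γ, and the values
ζ(-l) give the Bernoulli polynomials in β.

The link with the other series is d(k) = (k+x) α(k) and k = x(1-a/x): the k-th term equals α(k)
x^(1-2s) (2-a/x)(1-a/x)^(-s). Expanding in a/x and exchanging sums gives ζbar(s) = ∑_j
binomCoeff_j(s) ξ(2s+j-1). Since x ≥ n+1 > a, ξ(w) decays like (n+1)^(-Re w), so outside finitely
many terms the j-series converges locally uniformly for every s. This gives the continuation
`zetaBarCont`.

At s = -m the coefficients with j ≥ m+2 vanish. The possible poles of ξ(2s+j-1) occur only for 2m+2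
≤ j ≤ 2n+2m, where the factor s+m of the coefficient cancels them and leaves a multiple of a residue
γ. Everything that remains is a finite rational sum. -/

/-! ### Uniqueness of meromorphic continuations -/

theorem analyticAt_and_eq_of_meromorphicNFAt {F : ℂ → ℂ} {s v : ℂ} (hF : MeromorphicNFAt F s)
    (h : Tendsto F (𝓝[≠] s) (𝓝 v)) : AnalyticAt ℂ F s ∧ F s = v := by
  have h1 : AnalyticAt ℂ F s := by
    rw [← hF.meromorphicOrderAt_nonneg_iff_analyticAt]
    exact (tendsto_nhds_iff_meromorphicOrderAt_nonneg hF.meromorphicAt).1 ⟨v, h⟩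
  refine ⟨h1, ?_⟩
  exact tendsto_nhds_unique (h1.continuousAt.tendsto.mono_left nhdsWithin_le_nhds) h

/-- Identity theorem: F - G has infinite order at σ+1, and on the connected plane this propagates to
every point. Limits computed for an explicit G thus transfer to any continuation F. -/
theorem IsMeromorphicContinuation.eventuallyEq {σ : ℝ} {f F G : ℂ → ℂ}
    (hF : IsMeromorphicContinuation σ f F) (hG : ∀ s, MeromorphicAt G s)
    (hGf : ∀ s : ℂ, σ < s.re → G s = f s) (s : ℂ) : F =ᶠ[𝓝[≠] s] G := by
  have hm : MeromorphicOn (F - G) Set.univ := fun z _ =>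
    (hF.1 (Set.mem_univ z)).meromorphicAt.sub (hG z)
  have hx : meromorphicOrderAt (F - G) ((σ + 1 : ℝ) : ℂ) = ⊤ := by
    rw [meromorphicOrderAt_eq_top_iff]
    apply Filter.Eventually.filter_mono nhdsWithin_le_nhds
    have : {z : ℂ | σ < z.re} ∈ 𝓝 ((σ + 1 : ℝ) : ℂ) :=
      (isOpen_lt continuous_const Complex.continuous_re).mem_nhds (by simp)
    filter_upwards [this] with z hz
    simp [hF.2 z hz, hGf z hz]
  have hs : meromorphicOrderAt (F - G) s = ⊤ := by
    by_contra h
    exact hm.meromorphicOrderAt_ne_top_of_isPreconnected isPreconnected_univ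
      (Set.mem_univ s) (Set.mem_univ _) h hx
  rw [meromorphicOrderAt_eq_top_iff] at hs
  filter_upwards [hs] with z hz
  exact sub_eq_zero.1 hz

theorem isMeromorphicContinuation_toMeromorphicNFOn {σ : ℝ} {f G : ℂ → ℂ}
    (hG : ∀ s, MeromorphicAt G s) (hGf : ∀ s : ℂ, σ < s.re → G s = f s)
    (hGa : ∀ s : ℂ, σ < s.re → AnalyticAt ℂ G s) :
    IsMeromorphicContinuation σ f (toMeromorphicNFOn G Set.univ) := by
  refine ⟨meromorphicNFOn_toMeromorphicNFOn G _, fun s hs => ?_⟩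
  rw [toMeromorphicNFOn_eq_toMeromorphicNFAt (fun z _ => hG z) (Set.mem_univ s),
    toMeromorphicNFAt_eq_self.2 (hGa s hs).meromorphicNFAt, hGf s hs]

theorem IsMeromorphicContinuation.analyticAt_and_eq {σ : ℝ} {f F G : ℂ → ℂ}
    (hF : IsMeromorphicContinuation σ f F) (hG : ∀ s, MeromorphicAt G s)
    (hGf : ∀ s : ℂ, σ < s.re → G s = f s) {s v : ℂ} (h : Tendsto G (𝓝[≠] s) (𝓝 v)) :
    AnalyticAt ℂ F s ∧ F s = v :=
  analyticAt_and_eq_of_meromorphicNFAt (hF.1 (Set.mem_univ s))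
    (h.congr' (hF.eventuallyEq hG hGf s).symm)

/-! ### The shifted zeta function at positive integer shifts -/

/-- The Hurwitz zeta function `∑_{m ≥ 0} (m + M + 1)^{-s}`, for a natural number `M`. -/
noncomputable def zetaFrom (M : ℕ) (s : ℂ) : ℂ :=
  riemannZeta s - ∑ j ∈ Finset.range M, ((j : ℂ) + 1) ^ (-s)

theorem zetaFrom_succ (M : ℕ) (s : ℂ) :
    zetaFrom (M + 1) s = zetaFrom M s - ((M : ℂ) + 1) ^ (-s) := by
  simp [zetaFrom, Finset.sum_range_succ]; ring

/-- Removing one more term from the series matches B_r(x+1) = B_r(x) + r x^(r-1); the base case is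
the classical value of ζ(-l). -/
theorem zetaFrom_neg_nat (M l : ℕ) :
    zetaFrom M (-(l : ℂ)) =
      -((((Polynomial.bernoulli (l + 1)).eval ((M : ℚ) + 1) : ℚ) : ℂ) / ((l : ℂ) + 1)) := by
  induction M with
  | zero =>
    simp [zetaFrom, riemannZeta_neg_nat_eq_bernoulli', Polynomial.bernoulli_eval_one, neg_div]
  | succ M ih =>
    rw [zetaFrom_succ, ih]
    have := Polynomial.bernoulli_eval_one_add (l + 1) ((M : ℚ) + 1)
    have h2 : ((M + 1 : ℕ) : ℚ) + 1 = 1 + ((M : ℚ) + 1) := by push_cast; ring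
    rw [h2, this]
    have h0 : (l : ℂ) + 1 ≠ 0 := Nat.cast_add_one_ne_zero l
    push_cast
    rw [neg_neg, Complex.cpow_natCast]
    field_simp
    simp
    ring

theorem hasSum_zetaFrom (M : ℕ) {s : ℂ} (hs : 1 < s.re) :
    HasSum (fun m : ℕ => ((m : ℂ) + M + 1) ^ (-s)) (zetaFrom M s) := by
  have h1 : Summable fun m : ℕ => ((m : ℂ) + 1) ^ (-s) := by
    have := (summable_nat_add_iff 1).2 (Complex.summable_one_div_nat_cpow.2 hs)
    refine this.congr fun m => ?_
    rw [Complex.cpow_neg]; push_cast; simp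
  have h2 : HasSum (fun m : ℕ => ((m : ℂ) + 1) ^ (-s)) (riemannZeta s) := by
    rw [zeta_eq_tsum_one_div_nat_add_one_cpow hs]
    convert h1.hasSum using 4 with m
    rw [Complex.cpow_neg, one_div]
  have := (hasSum_nat_add_iff' M).2 h2
  simpa [zetaFrom] using this

theorem analyticAt_zetaFrom (M : ℕ) {s : ℂ} (hs : s ≠ 1) : AnalyticAt ℂ (zetaFrom M) s := by
  have h : DifferentiableOn ℂ (zetaFrom M) {1}ᶜ := by
    intro z hz
    apply DifferentiableAt.differentiableWithinAt
    refine (differentiableAt_riemannZeta hz).sub (DifferentiableAt.fun_sum fun j _ => ?_)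
    exact (differentiableAt_id.neg).const_cpow (Or.inl (Nat.cast_add_one_ne_zero j))
  exact h.analyticAt (isOpen_compl_singleton.mem_nhds hs)

theorem tendsto_sub_mul_zetaFrom (M : ℕ) :
    Tendsto (fun s => (s - 1) * zetaFrom M s) (𝓝[≠] 1) (𝓝 1) := by
  have h1 : Tendsto (fun s : ℂ => (s - 1) * ∑ j ∈ Finset.range M, ((j : ℂ) + 1) ^ (-s))
      (𝓝[≠] 1) (𝓝 0) := by
    have : ContinuousAt (fun s : ℂ => (s - 1) * ∑ j ∈ Finset.range M, ((j : ℂ) + 1) ^ (-s)) 1 := by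
      refine (continuousAt_id.sub continuousAt_const).mul (tendsto_finsetSum _ fun j _ => ?_)
      exact (continuousAt_id.neg).const_cpow (Or.inl (Nat.cast_add_one_ne_zero j))
    have h := this.tendsto.mono_left (nhdsWithin_le_nhds (s := {1}ᶜ))
    simpa using h
  simpa [zetaFrom, mul_sub] using riemannZeta_residue_one.sub h1

/-- Riemann's removable singularity theorem makes (s-x) f(s) analytic once its limit is filled in.
It turns the residue limit of ζ at 1 into meromorphy there. -/
theorem meromorphicAt_of_tendsto_sub_mul {f : ℂ → ℂ} {x v : ℂ}
    (hf : ∀ᶠ s in 𝓝[≠] x, AnalyticAt ℂ f s)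
    (h : Tendsto (fun s => (s - x) * f s) (𝓝[≠] x) (𝓝 v)) : MeromorphicAt f x := by
  have hg : AnalyticAt ℂ (Function.update (fun s => (s - x) * f s) x v) x := by
    apply Complex.analyticAt_of_differentiable_on_punctured_nhds_of_continuousAt
    · filter_upwards [hf, self_mem_nhdsWithin] with z hz hzx
      have : (fun s => (s - x) * f s) =ᶠ[𝓝 z] Function.update (fun s => (s - x) * f s) x v := by
        filter_upwards [isOpen_compl_singleton.mem_nhds hzx] with w hw
        rw [Function.update_of_ne hw]
      refine DifferentiableAt.congr_of_eventuallyEq ?_ this.symm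
      exact (differentiableAt_id.sub_const x).mul hz.differentiableAt
    · exact continuousAt_update_same.2 h
  have h2 : MeromorphicAt (fun s => (s - x)⁻¹ * Function.update (fun s => (s - x) * f s) x v s) x :=
    ((MeromorphicAt.id x).sub (MeromorphicAt.const x x)).inv.mul hg.meromorphicAt
  refine h2.congr ?_
  filter_upwards [self_mem_nhdsWithin] with z hz
  rw [Function.update_of_ne hz, inv_mul_cancel_left₀ (sub_ne_zero.2 hz)]

theorem meromorphicAt_zetaFrom (M : ℕ) (s : ℂ) : MeromorphicAt (zetaFrom M) s := by
  by_cases hs : s = 1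
  · subst hs
    refine meromorphicAt_of_tendsto_sub_mul ?_ (tendsto_sub_mul_zetaFrom M)
    filter_upwards [self_mem_nhdsWithin] with z hz using analyticAt_zetaFrom M hz
  · exact (analyticAt_zetaFrom M hs).meromorphicAt

/-! ### The polynomial behind α and the numerator of its generating function -/

theorem prod_Icc_add_eq_factorial_mul_choose (n k : ℕ) :
    ∏ j ∈ Finset.Icc 1 n, ((k : ℚ) + j) = n.factorial * (k + n).choose n := by
  have h := Nat.ascFactorial_eq_factorial_mul_choose k n
  rw [Nat.ascFactorial_eq_prod_range] at h
  rw [← Finset.Ico_succ_right_eq_Icc, Finset.prod_Ico_eq_prod_range, ← Nat.cast_mul, ← h]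
  push_cast
  simp [add_assoc]

/-- The polynomial interpolating `k ↦ α n q k` on the positive integers. -/
noncomputable def alphaPoly (n q : ℕ) : Polynomial ℚ :=
  Polynomial.C (1 / (((q - 1).factorial : ℚ) * (n - q).factorial * n.factorial)) *
    (∏ j ∈ (Finset.Icc 1 n).erase (n + 1 - q), (Polynomial.X + Polynomial.C (j : ℚ))) *
    ∏ i ∈ (Finset.Icc 1 n).erase q, (Polynomial.X + Polynomial.C ((i : ℚ) - q))

variable {n q : ℕ}

theorem natDegree_alphaPoly_lt (hq : 1 ≤ q) (hqn : q ≤ n) :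
    (alphaPoly n q).natDegree < 2 * n - 1 := by
  have h1 : (∏ j ∈ (Finset.Icc 1 n).erase (n + 1 - q),
      (Polynomial.X + Polynomial.C (j : ℚ))).natDegree ≤ n - 1 := by
    refine (Polynomial.natDegree_prod_le _ _).trans ?_
    simp only [Polynomial.natDegree_X_add_C, Finset.sum_const, smul_eq_mul, mul_one]
    rw [Finset.card_erase_of_mem (by simp; omega)]; simp
  have h2 : (∏ i ∈ (Finset.Icc 1 n).erase q,
      (Polynomial.X + Polynomial.C ((i : ℚ) - q))).natDegree ≤ n - 1 := by
    refine (Polynomial.natDegree_prod_le _ _).trans ?_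
    simp only [Polynomial.natDegree_X_add_C, Finset.sum_const, smul_eq_mul, mul_one]
    rw [Finset.card_erase_of_mem (by simp; omega)]; simp
  have h3 := (Polynomial.natDegree_mul_le_of_le
    ((Polynomial.natDegree_C_mul_le (1 / (((q - 1).factorial : ℚ) * (n - q).factorial *
      n.factorial)) _).trans h1) h2)
  rw [alphaPoly]
  omega

theorem eval_alphaPoly (hq : 1 ≤ q) (hqn : q ≤ n) {k : ℕ} (hk : 1 ≤ k) :
    (alphaPoly n q).eval (k : ℚ) = α n q k := by
  simp only [alphaPoly, Polynomial.eval_mul, Polynomial.eval_C, Polynomial.eval_prod,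
    Polynomial.eval_add, Polynomial.eval_X, α]
  have h1 := Finset.mul_prod_erase (Finset.Icc 1 n) (fun j : ℕ => (k : ℚ) + j)
    (a := n + 1 - q) (by simp; omega)
  have h2 := Finset.mul_prod_erase (Finset.Icc 1 n) (fun i : ℕ => (k : ℚ) + ((i : ℚ) - q))
    (a := q) (by simp; omega)
  split_ifs with hkq
  · obtain ⟨r, rfl⟩ := Nat.exists_eq_add_of_le hkq
    rw [prod_Icc_add_eq_factorial_mul_choose] at h1
    have h3 : ∏ i ∈ Finset.Icc 1 n, (((q + r : ℕ) : ℚ) + ((i : ℚ) - q)) =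
        n.factorial * (r + n).choose n := by
      rw [← prod_Icc_add_eq_factorial_mul_choose]
      exact Finset.prod_congr rfl fun i _ => by push_cast; ring
    rw [h3] at h2
    have e1 : (q + r + n).choose (q + r) = (q + r + n).choose n := Nat.choose_symm_add
    have e2 : (q + r - q + n).choose (q + r - q) = (r + n).choose n := by
      rw [Nat.add_sub_cancel_left]; exact Nat.choose_symm_add
    rw [e1, e2]
    have e3 : ((q + r + n + 1 - q : ℕ) : ℚ) = ((q + r : ℕ) : ℚ) + ((n + 1 - q : ℕ) : ℚ) := by
      rw [← Nat.cast_add]; congr 1; omega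
    rw [e3]
    have p1 : (((q + r : ℕ) : ℚ) + ((n + 1 - q : ℕ) : ℚ)) ≠ 0 := by
      rw [← Nat.cast_add]; exact Nat.cast_ne_zero.2 (by omega)
    have p2 : ((q + r : ℕ) : ℚ) ≠ 0 := Nat.cast_ne_zero.2 (by omega)
    have f1 : (n.factorial : ℚ) ≠ 0 := Nat.cast_ne_zero.2 n.factorial_ne_zero
    have f2 : ((q - 1).factorial : ℚ) ≠ 0 := Nat.cast_ne_zero.2 (Nat.factorial_ne_zero _)
    have f3 : ((n - q).factorial : ℚ) ≠ 0 := Nat.cast_ne_zero.2 (Nat.factorial_ne_zero _)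
    rw [sub_self, add_zero] at h2
    rw [mul_comm, ← eq_div_iff_mul_eq p1 ] at h1
    rw [mul_comm, ← eq_div_iff_mul_eq p2 ] at h2
    rw [h1, h2]
    field_simp
  -- For 1 ≤ k < q the factor with i = q - k vanishes, so the polynomial also reproduces the cut-off
  -- of α below q.
  · have : ∏ i ∈ (Finset.Icc 1 n).erase q, ((k : ℚ) + ((i : ℚ) - q)) = 0 := by
      apply Finset.prod_eq_zero (i := q - k)
      · simp; omega
      · rw [Nat.cast_sub (by omega)]; ring
    rw [this, mul_zero]

/-- Multiplication by 1 - X takes backward differences of the coefficients; the D-fold backward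
difference at k + D is the D-fold forward difference at k. -/
theorem coeff_one_sub_X_pow_mul_mk (f : ℕ → ℚ) (D k : ℕ) :
    PowerSeries.coeff (k + D) ((1 - PowerSeries.X) ^ D * PowerSeries.mk f) =
      (fwdDiff 1)^[D] f k := by
  induction D generalizing k with
  | zero => simp
  | succ D ih =>
    rw [pow_succ', mul_assoc, sub_mul, one_mul, map_sub, ← add_assoc,
      PowerSeries.coeff_succ_X_mul, ih, Function.iterate_succ_apply', fwdDiff, ← ih (k + 1)]
    congr 3
    omega

theorem c_eq_zero_of_le (hq : 1 ≤ q) (hqn : q ≤ n) {k : ℕ} (hk : 2 * n ≤ k) : c n q k = 0 := by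
  -- The differences must start at r + 1 ≥ 1: at 0 the polynomial is nonzero while α is 0, which is
  -- why the coefficient of index 2n-1 survives.
  obtain ⟨r, rfl⟩ : ∃ r, k = (r + 1) + (2 * n - 1) := ⟨k - 2 * n, by omega⟩
  have h := congrFun (Polynomial.fwdDiff_iter_eq_zero_of_degree_lt
    (natDegree_alphaPoly_lt hq hqn)) ((r + 1 : ℕ) : ℚ)
  rw [c, coeff_one_sub_X_pow_mul_mk, fwdDiff_iter_eq_sum_shift]
  rw [fwdDiff_iter_eq_sum_shift] at h
  rw [← Pi.zero_apply (M := fun _ => ℚ) ((r + 1 : ℕ) : ℚ), ← h]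
  refine Finset.sum_congr rfl fun j _ => ?_
  rw [← eval_alphaPoly hq hqn (by omega)]
  simp

theorem c_eq_zero_of_lt {k : ℕ} (hk : k < q) : c n q k = 0 := by
  rw [c, PowerSeries.coeff_mul]
  refine Finset.sum_eq_zero fun x hx => ?_
  rw [Finset.HasAntidiagonal.mem_antidiagonal] at hx
  rw [PowerSeries.coeff_mk, α, if_neg (by omega), mul_zero]

/-- Division of the numerator polynomial by (1-z)^(2n-1), whose inverse has binomial coefficients.
-/
theorem α_eq_sum (hq : 1 ≤ q) (hqn : q ≤ n) (N : ℕ) :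
    α n q N = ∑ k ∈ Finset.Icc q (2 * n - 1),
      if k ≤ N then c n q k * ((N - k + (2 * n - 2)).choose (2 * n - 2) : ℚ) else 0 := by
  have h : PowerSeries.mk (α n q) =
      ((1 - PowerSeries.X) ^ (2 * n - 1) * PowerSeries.mk (α n q)) *
        PowerSeries.mk fun m => (((2 * n - 2) + m).choose (2 * n - 2) : ℚ) := by
    have := PowerSeries.mk_add_choose_mul_one_sub_pow_eq_one ℚ (2 * n - 2)
    rw [show 2 * n - 2 + 1 = 2 * n - 1 by omega] at this
    rw [mul_comm _ (PowerSeries.mk fun m => _), ← mul_assoc, this, one_mul]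
  have h2 := congrArg (PowerSeries.coeff N) h
  rw [PowerSeries.coeff_mk, PowerSeries.coeff_mul,
    Finset.Nat.sum_antidiagonal_eq_sum_range_succ (fun i j =>
      PowerSeries.coeff i ((1 - PowerSeries.X) ^ (2 * n - 1) * PowerSeries.mk (α n q)) *
      PowerSeries.coeff j (PowerSeries.mk fun m => (((2 * n - 2) + m).choose (2 * n - 2) : ℚ)))] at h2
  rw [h2, ← Finset.sum_filter]
  symm
  refine Finset.sum_subset_zero_on_sdiff ?_ ?_ ?_
  · intro k; simp
  · intro k hk
    simp only [Finset.mem_sdiff, Finset.mem_range, Finset.mem_filter, Finset.mem_Icc] at hk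
    have : c n q k = 0 := by
      by_cases h : k < q
      · exact c_eq_zero_of_lt h
      · exact c_eq_zero_of_le hq hqn (by omega)
    rw [c] at this
    rw [this, zero_mul]
  · intro k _
    rw [PowerSeries.coeff_mk, add_comm, c]

theorem sum_b_mul_pow (hn : 1 ≤ n) (m : ℕ) :
    ∑ i ∈ Finset.range (2 * n - 1), b n i * (m : ℚ) ^ i =
      ((m + (2 * n - 2)).choose (2 * n - 2) : ℚ) := by
  have hd : (Polynomial.C (1 / ((2 * n - 2).factorial : ℚ)) *
      ∏ r ∈ Finset.Icc 1 (2 * n - 2), (Polynomial.X + Polynomial.C (r : ℚ))).natDegree <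
        2 * n - 1 := by
    refine (Polynomial.natDegree_C_mul_le _ _).trans_lt
      ((Polynomial.natDegree_prod_le _ _).trans_lt ?_)
    simp only [Polynomial.natDegree_X_add_C, Finset.sum_const, smul_eq_mul, mul_one, Nat.card_Icc]
    omega
  have h := Polynomial.eval_eq_sum_range' hd (m : ℚ)
  simp only [b]
  rw [← h]
  simp only [Polynomial.eval_mul, Polynomial.eval_C, Polynomial.eval_prod, Polynomial.eval_add,
    Polynomial.eval_X]
  rw [prod_Icc_add_eq_factorial_mul_choose]
  field_simp

theorem α_nonneg (k : ℕ) : 0 ≤ α n q k := by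
  rw [α]; split_ifs <;> positivity

theorem cast_add_add_one_sub {R : Type*} [Ring R] (hqn : q ≤ n) (k : ℕ) :
    ((k + n + 1 - q : ℕ) : R) = (k : R) + n + 1 - q := by
  rw [Nat.cast_sub (by omega)]; push_cast; rfl

/-! ### Continuation, residues and special values of ξ -/

/-- The meromorphic continuation of `xiIntegral n q`, as a combination of shifted zeta
functions. -/
noncomputable def xiCont (n q : ℕ) (s : ℂ) : ℂ :=
  ∑ k ∈ Finset.Icc q (2 * n - 1), (c n q k : ℂ) *
    ∑ i ∈ Finset.range (2 * n - 1), (b n i : ℂ) *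
      ∑ p ∈ Finset.range (i + 1), (i.choose p : ℂ) * ((q : ℂ) - n - 1 - k) ^ (i - p) *
        zetaFrom (k + n - q) (s - p)

theorem xiCont_neg_nat (hqn : q ≤ n) (l : ℕ) :
    xiCont n q (-(l : ℂ)) =
      -∑ i ∈ Finset.range (2 * n - 1), (b n i : ℂ) *
        ∑ p ∈ Finset.range (i + 1), (i.choose p : ℂ) *
          ((β n q l i p : ℂ) / ((p : ℂ) + l + 1)) := by
  have hz (k p : ℕ) : zetaFrom (k + n - q) (-(l : ℂ) - p) =
      -((((Polynomial.bernoulli (l + p + 1)).eval ((k : ℚ) + n + 1 - q) : ℚ) : ℂ) /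
        ((p : ℂ) + l + 1)) := by
    have := zetaFrom_neg_nat (k + n - q) (l + p)
    rw [Nat.cast_sub (by omega)] at this
    push_cast at this
    rw [show -(l : ℂ) - p = -((l : ℂ) + p) by ring, this,
      show (k : ℚ) + n - q + 1 = (k : ℚ) + n + 1 - q by ring, add_comm (l : ℂ)]
  simp only [xiCont, hz, β]
  push_cast
  simp only [Finset.mul_sum, Finset.sum_div, ← Finset.sum_neg_distrib]
  rw [Finset.sum_comm]
  refine Finset.sum_congr rfl fun i _ => ?_
  rw [Finset.sum_comm]
  refine Finset.sum_congr rfl fun p _ => Finset.sum_congr rfl fun k _ => ?_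
  ring

theorem meromorphicAt_xiCont (n q : ℕ) (s : ℂ) : MeromorphicAt (xiCont n q) s := by
  have h (k p : ℕ) : MeromorphicAt (fun s : ℂ => zetaFrom (k + n - q) (s - p)) s :=
    (meromorphicAt_zetaFrom (k + n - q) (s - p)).comp_analyticAt
      (g := fun s : ℂ => s - p) (by fun_prop)
  unfold xiCont
  fun_prop

theorem analyticAt_xiCont {s : ℂ} (hs : ∀ l ∈ Finset.Icc 1 (2 * n - 1), s ≠ (l : ℂ)) :
    AnalyticAt ℂ (xiCont n q) s := by
  unfold xiCont
  refine Finset.analyticAt_fun_sum _ fun k _ => analyticAt_const.mul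
    (Finset.analyticAt_fun_sum _ fun i hi => analyticAt_const.mul
    (Finset.analyticAt_fun_sum _ fun p hp => analyticAt_const.mul ?_))
  refine (analyticAt_zetaFrom (k + n - q) (s := s - p) fun h => ?_).comp_of_eq
    (f := fun s : ℂ => s - p) (by fun_prop) rfl
  rw [Finset.mem_range] at hi hp
  apply hs (p + 1) (by simp; omega)
  rw [sub_eq_iff_eq_add] at h
  rw [h]; push_cast; ring

theorem analyticAt_xiCont_of_lt_re {s : ℂ} (hs : (2 * n - 1 : ℝ) < s.re) :
    AnalyticAt ℂ (xiCont n q) s := by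
  refine analyticAt_xiCont fun l hl h => ?_
  rw [h, Complex.natCast_re] at hs
  rw [Finset.mem_Icc] at hl
  have : (l : ℝ) + 1 ≤ 2 * n := by exact_mod_cast (by omega : l + 1 ≤ 2 * n)
  linarith

theorem analyticAt_xiCont_neg_nat (l : ℕ) : AnalyticAt ℂ (xiCont n q) (-(l : ℂ)) := by
  refine analyticAt_xiCont fun j hj h => ?_
  have : ((l + j : ℕ) : ℂ) = 0 := by push_cast; rw [← h]; ring
  rw [Nat.cast_eq_zero] at this
  rw [Finset.mem_Icc] at hj
  omega

theorem tendsto_sub_mul_zetaFrom_sub (M p l : ℕ) :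
    Tendsto (fun s : ℂ => (s - l) * zetaFrom M (s - p)) (𝓝[≠] (l : ℂ))
      (𝓝 (if p + 1 = l then 1 else 0)) := by
  split_ifs with h
  · subst h
    have hc : Tendsto (fun s : ℂ => s - p) (𝓝[≠] ((p + 1 : ℕ) : ℂ)) (𝓝[≠] 1) := by
      refine tendsto_nhdsWithin_iff.2 ⟨?_, ?_⟩
      · have : ContinuousAt (fun s : ℂ => s - p) ((p + 1 : ℕ) : ℂ) := by fun_prop
        have h := this.tendsto.mono_left (nhdsWithin_le_nhds (s := {((p + 1 : ℕ) : ℂ)}ᶜ))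
        simpa using h
      · filter_upwards [self_mem_nhdsWithin] with s hs h
        apply hs
        rw [Set.mem_singleton_iff, sub_eq_iff_eq_add] at h
        rw [Set.mem_singleton_iff, h]; push_cast; ring
    refine ((tendsto_sub_mul_zetaFrom M).comp hc).congr fun s => ?_
    simp only [Function.comp]
    push_cast; ring
  · have ha : AnalyticAt ℂ (fun s : ℂ => zetaFrom M (s - p)) l := by
      refine (analyticAt_zetaFrom M (s := l - p) fun h' => h ?_).comp_of_eq
        (f := fun s : ℂ => s - p) (by fun_prop) rfl
      rw [sub_eq_iff_eq_add] at h'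
      have : (l : ℂ) = ((p + 1 : ℕ) : ℂ) := by rw [h']; push_cast; ring
      exact (Nat.cast_injective this).symm
    have h2 : ContinuousAt (fun s : ℂ => (s - l) * zetaFrom M (s - p)) l :=
      (continuousAt_id.sub continuousAt_const).mul ha.continuousAt
    have := h2.tendsto.mono_left (nhdsWithin_le_nhds (s := {(l : ℂ)}ᶜ))
    simpa using this

theorem tendsto_sub_mul_xiCont {l : ℕ} (hl : l ∈ Finset.Icc 1 (2 * n - 1)) :
    Tendsto (fun s : ℂ => (s - l) * xiCont n q s) (𝓝[≠] (l : ℂ)) (𝓝 (γ n q l : ℂ)) := by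
  rw [Finset.mem_Icc] at hl
  have h : Tendsto (fun s : ℂ => ∑ k ∈ Finset.Icc q (2 * n - 1), (c n q k : ℂ) *
      ∑ i ∈ Finset.range (2 * n - 1), (b n i : ℂ) *
        ∑ p ∈ Finset.range (i + 1), (i.choose p : ℂ) * ((q : ℂ) - n - 1 - k) ^ (i - p) *
          ((s - l) * zetaFrom (k + n - q) (s - p))) (𝓝[≠] (l : ℂ))
      (𝓝 (∑ k ∈ Finset.Icc q (2 * n - 1), (c n q k : ℂ) *
      ∑ i ∈ Finset.range (2 * n - 1), (b n i : ℂ) *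
        ∑ p ∈ Finset.range (i + 1), (i.choose p : ℂ) * ((q : ℂ) - n - 1 - k) ^ (i - p) *
          (if p + 1 = l then 1 else 0))) :=
    tendsto_finsetSum _ fun k _ => (tendsto_finsetSum _ fun i _ =>
      (tendsto_finsetSum _ fun p _ =>
        (tendsto_sub_mul_zetaFrom_sub _ p l).const_mul _).const_mul _).const_mul _
  convert h using 2
  · simp only [xiCont, Finset.mul_sum]
    refine Finset.sum_congr rfl fun k _ => Finset.sum_congr rfl fun i _ =>
      Finset.sum_congr rfl fun p _ => ?_
    ring
  · simp only [γ]
    push_cast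
    refine Finset.sum_congr rfl fun k _ => congrArg _ ?_
    refine Finset.sum_subset_zero_on_sdiff (fun i => by simp; omega) ?_ ?_
    · intro i hi
      simp only [Finset.mem_sdiff, Finset.mem_range, Finset.mem_Icc] at hi
      rw [Finset.sum_eq_zero, mul_zero]
      intro p hp
      rw [Finset.mem_range] at hp
      rw [if_neg (by omega), mul_zero]
    · intro i hi
      simp only [Finset.mem_Icc] at hi
      rw [Finset.sum_eq_single (l - 1), if_pos (by omega)]
      · ring
      · intro p _ hp
        rw [if_neg (by omega), mul_zero]
      · intro hp
        simp at hp; omega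

theorem hasSum_xiCont (hq : 1 ≤ q) (hqn : q ≤ n) {s : ℂ} (hs : (2 * n - 1 : ℝ) < s.re) :
    HasSum (fun N : ℕ => (α n q N : ℂ) * ((N + n + 1 - q : ℕ) : ℂ) ^ (-s)) (xiCont n q s) := by
  have hx (m k : ℕ) : (m : ℂ) + (k + n - q : ℕ) + 1 = ((m + k + n + 1 - q : ℕ) : ℂ) := by
    rw [← Nat.cast_add, ← Nat.cast_add_one]; congr 1; omega
  have h1 (k : ℕ) : HasSum (fun m : ℕ => ((m + (2 * n - 2)).choose (2 * n - 2) : ℂ) *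
      ((m + k + n + 1 - q : ℕ) : ℂ) ^ (-s))
      (∑ i ∈ Finset.range (2 * n - 1), (b n i : ℂ) *
        ∑ p ∈ Finset.range (i + 1), (i.choose p : ℂ) * ((q : ℂ) - n - 1 - k) ^ (i - p) *
          zetaFrom (k + n - q) (s - p)) := by
    have h2 : HasSum (fun m : ℕ => ∑ i ∈ Finset.range (2 * n - 1), (b n i : ℂ) *
        ∑ p ∈ Finset.range (i + 1), (i.choose p : ℂ) * ((q : ℂ) - n - 1 - k) ^ (i - p) *
          ((m : ℂ) + (k + n - q : ℕ) + 1) ^ (-(s - p)))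
        (∑ i ∈ Finset.range (2 * n - 1), (b n i : ℂ) *
        ∑ p ∈ Finset.range (i + 1), (i.choose p : ℂ) * ((q : ℂ) - n - 1 - k) ^ (i - p) *
          zetaFrom (k + n - q) (s - p)) := by
      refine hasSum_sum fun i hi => (hasSum_sum fun p hp => (hasSum_zetaFrom _ ?_).mul_left _).mul_left _
      rw [Finset.mem_range] at hi hp
      have : (p : ℝ) + 2 ≤ 2 * n := by exact_mod_cast (by omega : p + 2 ≤ 2 * n)
      simp only [Complex.sub_re, Complex.natCast_re]
      linarith
    convert h2 using 2 with m
    have hb := congrArg (Rat.cast (K := ℂ)) (sum_b_mul_pow (hq.trans hqn) m)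
    push_cast at hb
    rw [← hb, Finset.sum_mul]
    refine Finset.sum_congr rfl fun i _ => ?_
    rw [mul_assoc]
    congr 1
    have hx0 : ((m + k + n + 1 - q : ℕ) : ℂ) ≠ 0 := Nat.cast_ne_zero.2 (by omega)
    -- Re-centring m at x = m+k+a turns m^i into a binomial sum of powers x^p, and x^p x^(-s) is a
    -- term of the zeta function at s - p.
    have hm : (m : ℂ) = ((m + k + n + 1 - q : ℕ) : ℂ) + ((q : ℂ) - n - 1 - k) := by
      rw [cast_add_add_one_sub hqn]; push_cast; ring
    rw [hx]
    conv_lhs => rw [hm]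
    rw [add_pow, Finset.sum_mul]
    refine Finset.sum_congr rfl fun p _ => ?_
    rw [neg_sub, sub_eq_add_neg (p : ℂ) s, Complex.cpow_add _ _ hx0, Complex.cpow_natCast]
    ring
  have h3 (k : ℕ) : HasSum (fun N : ℕ => if k ≤ N then
      ((N - k + (2 * n - 2)).choose (2 * n - 2) : ℂ) * ((N + n + 1 - q : ℕ) : ℂ) ^ (-s) else 0)
      (∑ i ∈ Finset.range (2 * n - 1), (b n i : ℂ) *
        ∑ p ∈ Finset.range (i + 1), (i.choose p : ℂ) * ((q : ℂ) - n - 1 - k) ^ (i - p) *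
          zetaFrom (k + n - q) (s - p)) := by
    rw [← hasSum_nat_add_iff' k, Finset.sum_eq_zero (s := Finset.range k) fun i hi =>
      if_neg (not_le.2 (Finset.mem_range.1 hi)), sub_zero]
    refine (h1 k).congr_fun fun m => ?_
    simp
  unfold xiCont
  refine (hasSum_sum fun k _ => (h3 k).mul_left (c n q k : ℂ)).congr_fun fun N => ?_
  rw [α_eq_sum hq hqn]
  push_cast
  rw [Finset.sum_mul]
  refine Finset.sum_congr rfl fun k _ => ?_
  split_ifs <;> simp [mul_assoc]

/-! ### The Mellin integral -/

theorem summable_α_mul_pow (hq : 1 ≤ q) (hqn : q ≤ n) {z : ℂ} (hz : ‖z‖ < 1) :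
    Summable fun k : ℕ => (α n q k : ℂ) * z ^ k := by
  have h : Summable fun k : ℕ => (((alphaPoly n q).eval (k : ℚ) : ℚ) : ℂ) * z ^ k := by
    simp only [Polynomial.eval_eq_sum_range, Rat.cast_sum, Finset.sum_mul]
    refine summable_sum fun i _ => ?_
    refine ((summable_pow_mul_geometric_of_norm_lt_one i hz).mul_left
      (((alphaPoly n q).coeff i : ℚ) : ℂ)).congr fun k => ?_
    push_cast; ring
  rw [← summable_nat_add_iff 1] at h ⊢
  refine h.congr fun k => ?_
  rw [eval_alphaPoly hq hqn (by omega)]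

theorem hasSum_mellin_xiKernel (hq : 1 ≤ q) (hqn : q ≤ n) {s : ℂ} (hs : (2 * n - 1 : ℝ) < s.re) :
    HasSum (fun k : ℕ => Complex.Gamma s * (α n q k : ℂ) / (((k + n + 1 - q : ℕ) : ℝ) : ℂ) ^ s)
      (mellin (xiKernel n q) s) := by
  have hn : (1 : ℝ) ≤ n := by exact_mod_cast hq.trans hqn
  refine hasSum_mellin (fun k => Or.inr (Nat.cast_pos.2 (by omega))) (by linarith) ?_ ?_
  · intro t ht
    have hz : ‖Complex.exp (-(t : ℂ))‖ < 1 := by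
      rw [Complex.norm_exp]; simpa using ht
    refine ((summable_α_mul_pow hq hqn hz).hasSum.mul_right
      (Complex.exp (-((n : ℂ) + 1 - q) * t))).congr_fun fun k => ?_
    rw [mul_assoc, ← Complex.exp_nat_mul, ← Complex.exp_add, Complex.ofReal_exp]
    congr 2
    push_cast
    rw [cast_add_add_one_sub hqn]
    ring
  · refine (hasSum_xiCont hq hqn hs).summable.norm.congr fun k => ?_
    rw [norm_mul, Complex.norm_natCast_cpow_of_pos (by omega), Complex.neg_re,
      Real.rpow_neg (Nat.cast_nonneg _), div_eq_mul_inv]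

theorem xiCont_eq_xiIntegral (hq : 1 ≤ q) (hqn : q ≤ n) {s : ℂ} (hs : (2 * n - 1 : ℝ) < s.re) :
    xiCont n q s = xiIntegral n q s := by
  have hn : (1 : ℝ) ≤ n := by exact_mod_cast hq.trans hqn
  have hG : Complex.Gamma s ≠ 0 := Complex.Gamma_ne_zero_of_re_pos (by linarith)
  have h := (hasSum_xiCont hq hqn hs).mul_left (Complex.Gamma s)
  have h2 : mellin (xiKernel n q) s = Complex.Gamma s * xiCont n q s := by
    refine (hasSum_mellin_xiKernel hq hqn hs).unique (h.congr_fun fun k => ?_)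
    rw [Complex.cpow_neg, Complex.ofReal_natCast]; ring
  rw [xiIntegral, h2]
  field_simp

/-- The norm of t^(s-1) depends only on Re s. Measurability of f is recovered by multiplying the
integrand by the inverse power. -/
theorem mellinConvergent_ofReal_re {f : ℝ → ℂ} {s : ℂ} (h : MellinConvergent f (s.re : ℂ)) :
    MellinConvergent f s := by
  have hf : MeasureTheory.AEStronglyMeasurable f
      (MeasureTheory.volume.restrict (Set.Ioi 0)) := by
    have hc : MeasureTheory.AEStronglyMeasurable (fun t : ℝ => (t : ℂ) ^ (-((s.re : ℂ) - 1)))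
        (MeasureTheory.volume.restrict (Set.Ioi 0)) := by
      refine ContinuousOn.aestronglyMeasurable (fun t ht => ?_) measurableSet_Ioi
      exact (Complex.continuousAt_ofReal_cpow_const _ _
        (Or.inr (ne_of_gt ht))).continuousWithinAt
    refine (hc.smul h.aestronglyMeasurable).congr ?_
    filter_upwards [MeasureTheory.ae_restrict_mem measurableSet_Ioi] with t ht
    have h0 : (t : ℂ) ≠ 0 := Complex.ofReal_ne_zero.2 (ne_of_gt ht)
    simp only [Pi.smul_apply', smul_eq_mul]
    rw [← mul_assoc, ← Complex.cpow_add _ _ h0]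
    simp
  rw [MellinConvergent, mellin_convergent_iff_norm subset_rfl measurableSet_Ioi hf] at h ⊢
  simpa using h

theorem mellinConvergent_xiKernel (hq : 1 ≤ q) (hqn : q ≤ n) {s : ℂ}
    (hs : (2 * n - 1 : ℝ) < s.re) : MellinConvergent (xiKernel n q) s := by
  have hn : (1 : ℝ) ≤ n := by exact_mod_cast hq.trans hqn
  have hs0 : 0 < s.re := by linarith
  apply mellinConvergent_ofReal_re
  by_contra hcon
  -- A non-integrable integrand has integral 0 by convention, whereas the termwise formula at a real
  -- exponent is a sum of nonnegative terms with a positive one at k = q.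
  have h0 : mellin (xiKernel n q) (s.re : ℂ) = 0 := MeasureTheory.integral_undef hcon
  have h := hasSum_mellin_xiKernel hq hqn (s := (s.re : ℂ)) (by simpa using hs)
  rw [h0] at h
  have e (k : ℕ) : (Complex.Gamma (s.re : ℂ) * (α n q k : ℂ) /
      (((k + n + 1 - q : ℕ) : ℝ) : ℂ) ^ (s.re : ℂ)) =
      ((Real.Gamma s.re * (α n q k : ℝ) / ((k + n + 1 - q : ℕ) : ℝ) ^ s.re : ℝ) : ℂ) := by
    rw [Complex.Gamma_ofReal, ← Complex.ofReal_cpow (Nat.cast_nonneg _)]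
    push_cast; rfl
  simp only [e] at h
  have h' : HasSum (fun k => Real.Gamma s.re * (α n q k : ℝ) /
      ((k + n + 1 - q : ℕ) : ℝ) ^ s.re) 0 := Complex.hasSum_ofReal.1 (by simpa only [Complex.ofReal_zero] using h)
  have hle := le_hasSum h' q fun k _ => by
    have := α_nonneg (n := n) (q := q) k
    have h1 : (0 : ℝ) ≤ (α n q k : ℝ) := by exact_mod_cast this
    have := Real.Gamma_pos_of_pos hs0
    positivity
  have hα : 0 < α n q q := by
    rw [α, if_pos le_rfl]
    have h1 : 0 < (q + n).choose q := Nat.choose_pos (by omega)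
    have h2 : 0 < (q - q + n).choose (q - q) := Nat.choose_pos (by omega)
    have h3 : 0 < q + n + 1 - q := by omega
    positivity
  have hα' : (0 : ℝ) < (α n q q : ℝ) := by exact_mod_cast hα
  have hx : (0 : ℝ) < ((q + n + 1 - q : ℕ) : ℝ) := Nat.cast_pos.2 (by omega)
  have := Real.Gamma_pos_of_pos hs0
  exact absurd hle (not_le.2 (by positivity))

/-! ### The binomial expansion and its majorant -/

theorem hasSum_one_sub_cpow_neg (s : ℂ) {t : ℂ} (ht : ‖t‖ < 1) :
    HasSum (fun j : ℕ => (∏ i ∈ Finset.range j, (s + i)) / (j.factorial : ℂ) * t ^ j)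
      ((1 - t) ^ (-s)) := by
  have h := (Complex.one_div_one_sub_cpow_hasFPowerSeriesOnBall_zero s).hasSum (y := t) (by
    rw [Metric.mem_eball, edist_zero_right, enorm_eq_nnnorm]
    exact_mod_cast ht)
  rw [zero_add, one_div, ← Complex.cpow_neg] at h
  refine h.congr_fun fun j => ?_
  have h1 : (∏ i ∈ Finset.range j, (s + i)) = (j.factorial : ℂ) * Ring.choose (s + j - 1) j := by
    rw [← Ring.multichoose_eq, ← nsmul_eq_mul, Ring.factorial_nsmul_multichoose_eq_ascPochhammer,
      Polynomial.ascPochhammer_smeval_eq_eval]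
    induction j with
    | zero => simp
    | succ j ih => rw [Finset.prod_range_succ, ascPochhammer_succ_eval, ih]
  rw [h1, mul_div_cancel_left₀ _ (Nat.cast_ne_zero.2 j.factorial_ne_zero)]
  simp [mul_comm]

/-- The coefficients of the expansion of `(2 - a t) (1 - a t)^{-s}` in powers of `t`. -/
noncomputable def binomCoeff (a : ℕ) (s : ℂ) : ℕ → ℂ
  | 0 => 2
  | j + 1 => (a : ℂ) ^ (j + 1) / ((j + 1).factorial : ℂ) * (∏ i ∈ Finset.range j, (s + i)) *
      (2 * s + j - 1)

/-- The linear factor of the coefficient comes from 2(s+j) - (j+1) = 2s+j-1. -/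
theorem hasSum_binomCoeff (a : ℕ) (s : ℂ) {t : ℂ} (ht : ‖a * t‖ < 1) :
    HasSum (fun j => binomCoeff a s j * t ^ j) ((2 - a * t) * (1 - a * t) ^ (-s)) := by
  have h := hasSum_one_sub_cpow_neg s ht
  rw [← hasSum_nat_add_iff' 1]
  have h2 := (((hasSum_nat_add_iff' 1).2 h).mul_left 2).sub (h.mul_left (a * t))
  have e : (2 - a * t) * (1 - a * t) ^ (-s) -
      ∑ i ∈ Finset.range 1, binomCoeff a s i * t ^ i =
      2 * ((1 - a * t) ^ (-s) - ∑ i ∈ Finset.range 1,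
        (∏ l ∈ Finset.range i, (s + l)) / (i.factorial : ℂ) * (a * t) ^ i) -
        a * t * (1 - a * t) ^ (-s) := by
    simp [binomCoeff]
    ring
  rw [e]
  refine h2.congr_fun fun j => ?_
  have h1 : (j.factorial : ℂ) ≠ 0 := Nat.cast_ne_zero.2 j.factorial_ne_zero
  have h3 : (j : ℂ) + 1 ≠ 0 := Nat.cast_add_one_ne_zero j
  simp only [binomCoeff, Finset.prod_range_succ, Nat.factorial_succ, mul_pow]
  push_cast
  field_simp
  ring

/-- Replacing s by R ≥ ‖s‖ and the subtraction by an addition gives a binomial series at aρ < 1,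
uniform on the disc. -/
theorem exists_summable_binomCoeff_bound (a : ℕ) {ρ : ℝ} (hρ : 0 ≤ ρ) (ha : a * ρ < 1) {R : ℝ}
    (hR : 0 ≤ R) : ∃ u : ℕ → ℝ, Summable u ∧
      ∀ (s : ℂ), ‖s‖ ≤ R → ∀ j, ‖binomCoeff a s j‖ * ρ ^ j ≤ u j := by
  have h : Summable fun j : ℕ => (∏ i ∈ Finset.range j, (R + i)) / (j.factorial : ℝ) *
      (a * ρ) ^ j := by
    have h1 : ‖((a * ρ : ℝ) : ℂ)‖ < 1 := by
      rw [Complex.norm_real, Real.norm_of_nonneg (by positivity)]; exact ha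
    refine (hasSum_one_sub_cpow_neg (R : ℂ) h1).summable.norm.congr fun j => ?_
    rw [show (∏ i ∈ Finset.range j, ((R : ℂ) + i)) / (j.factorial : ℂ) * ((a * ρ : ℝ) : ℂ) ^ j =
      (((∏ i ∈ Finset.range j, (R + i)) / (j.factorial : ℝ) * (a * ρ) ^ j : ℝ) : ℂ) by
        push_cast; rfl, Complex.norm_real, Real.norm_of_nonneg]
    have : 0 ≤ ∏ i ∈ Finset.range j, (R + (i : ℝ)) :=
      Finset.prod_nonneg fun i _ => by positivity
    positivity
  set g : ℕ → ℝ := fun j => (∏ i ∈ Finset.range j, (R + i)) / (j.factorial : ℝ) * (a * ρ) ^ j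
  refine ⟨fun j => Nat.casesOn j 2 fun j => 2 * g (j + 1) + a * ρ * g j, ?_, ?_⟩
  · rw [← summable_nat_add_iff 1]
    exact (((summable_nat_add_iff 1).2 h).mul_left 2).add (h.mul_left _)
  · intro s hs j
    cases j with
    | zero => simp [binomCoeff]
    | succ j =>
      have hprod : ‖∏ i ∈ Finset.range j, (s + i)‖ ≤ ∏ i ∈ Finset.range j, (R + i) := by
        rw [norm_prod]
        refine Finset.prod_le_prod (fun _ _ => norm_nonneg _) fun i _ => ?_
        refine (norm_add_le _ _).trans ?_
        rw [Complex.norm_natCast]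
        linarith
      have hlin : ‖2 * s + j - 1‖ ≤ 2 * R + j + 1 := by
        refine (norm_sub_le _ _).trans ?_
        refine (add_le_add_left (norm_add_le _ _) _).trans ?_
        simp only [norm_mul, Complex.norm_ofNat, Complex.norm_natCast, norm_one]
        linarith
      have hp : 0 ≤ ∏ i ∈ Finset.range j, (R + (i : ℝ)) :=
        Finset.prod_nonneg fun i _ => by positivity
      simp only [binomCoeff, norm_mul, norm_div, norm_pow, Complex.norm_natCast]
      calc (a : ℝ) ^ (j + 1) / ((j + 1).factorial : ℝ) * ‖∏ i ∈ Finset.range j, (s + i)‖ *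
            ‖2 * s + j - 1‖ * ρ ^ (j + 1)
          ≤ (a : ℝ) ^ (j + 1) / ((j + 1).factorial : ℝ) * (∏ i ∈ Finset.range j, (R + i)) *
            (2 * R + j + 1) * ρ ^ (j + 1) := by gcongr
        _ ≤ (a : ℝ) ^ (j + 1) / ((j + 1).factorial : ℝ) * (∏ i ∈ Finset.range j, (R + i)) *
            (2 * (R + j) + (j + 1)) * ρ ^ (j + 1) := by
              have : (0 : ℝ) ≤ j := Nat.cast_nonneg j
              gcongr ?_ * ?_ * _
              linarith
        _ = 2 * g (j + 1) + a * ρ * g j := by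
              simp only [g, Finset.prod_range_succ, Nat.factorial_succ, mul_pow]
              push_cast
              have h1 : (j.factorial : ℝ) ≠ 0 := Nat.cast_ne_zero.2 j.factorial_ne_zero
              have h2 : (j : ℝ) + 1 ≠ 0 := Nat.cast_add_one_ne_zero j
              field_simp
              ring

/-! ### Continuation of the series for ζbar -/

/-- The terms of the expansion of `zetaBarSeries n q` in shifted values of `xiIntegral n q`. -/
noncomputable def zetaBarContTerm (n q j : ℕ) (s : ℂ) : ℂ :=
  binomCoeff (n + 1 - q) s j * xiCont n q (2 * s + j - 1)

/-- The meromorphic continuation of `zetaBarSeries n q`. -/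
noncomputable def zetaBarCont (n q : ℕ) (s : ℂ) : ℂ :=
  ∑' j, zetaBarContTerm n q j s

/-- Every base with α ≠ 0 is at least n+1, since k ≥ q; raising the exponent therefore gains a power
of n+1. -/
theorem norm_α_mul_cpow_le {w z : ℂ} (hzw : z.re ≤ w.re) (k : ℕ) :
    ‖(α n q k : ℂ) * ((k + n + 1 - q : ℕ) : ℂ) ^ (-w)‖ ≤
      ‖(α n q k : ℂ) * ((k + n + 1 - q : ℕ) : ℂ) ^ (-z)‖ *
        ((n : ℝ) + 1) ^ (-(w.re - z.re)) := by
  by_cases hk : q ≤ k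
  · have hx : 0 < k + n + 1 - q := by omega
    have hx' : (0 : ℝ) < ((k + n + 1 - q : ℕ) : ℝ) := Nat.cast_pos.2 hx
    rw [norm_mul, norm_mul, Complex.norm_natCast_cpow_of_pos hx,
      Complex.norm_natCast_cpow_of_pos hx, mul_assoc]
    gcongr
    rw [show (-w).re = (-z).re + -(w.re - z.re) by simp only [Complex.neg_re]; ring, Real.rpow_add hx']
    refine mul_le_mul_of_nonneg_left ?_ (by positivity)
    refine Real.rpow_le_rpow_of_nonpos (by positivity) ?_ (by linarith)
    exact_mod_cast (by omega : n + 1 ≤ k + n + 1 - q)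
  · simp [α, hk]

theorem exists_norm_xiCont_le (hq : 1 ≤ q) (hqn : q ≤ n) :
    ∃ K : ℝ, 0 ≤ K ∧ ∀ w : ℂ, (2 * n : ℝ) ≤ w.re →
      ‖xiCont n q w‖ ≤ K * ((n : ℝ) + 1) ^ (-(w.re - 2 * n)) := by
  have h := (hasSum_xiCont hq hqn (s := 2 * n) (by simp)).summable.norm
  refine ⟨_, h.hasSum.nonneg fun k => norm_nonneg _, fun w hw => ?_⟩
  rw [← (hasSum_xiCont hq hqn (s := w) (by linarith)).tsum_eq]
  refine tsum_of_norm_bounded (h.hasSum.mul_right _) fun k => ?_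
  have := norm_α_mul_cpow_le (n := n) (q := q) (w := w) (z := 2 * n) (by simpa using hw) k
  simpa using this

/-- The offset 2n+1+2R forces Re(2s+j-1) ≥ 2n on the disc, clear of all poles of ξ. The decay of ξ
supplies ρ = 1/(n+1), and aρ < 1 because q ≥ 1. -/
theorem exists_summable_zetaBarContTerm_bound (hq : 1 ≤ q) (hqn : q ≤ n) (R : ℕ) :
    ∃ u : ℕ → ℝ, Summable u ∧ ∀ (s : ℂ), ‖s‖ ≤ R → ∀ j,
      ‖zetaBarContTerm n q (j + (2 * n + 1 + 2 * R)) s‖ ≤ u j := by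
  obtain ⟨K, hK, hxi⟩ := exists_norm_xiCont_le hq hqn
  have hn1 : (0 : ℝ) < n + 1 := by positivity
  obtain ⟨u, hu, hb⟩ := exists_summable_binomCoeff_bound (n + 1 - q) (ρ := ((n : ℝ) + 1)⁻¹)
    (by positivity) (by
      rw [← div_eq_mul_inv, div_lt_one hn1]
      exact_mod_cast (by omega : n + 1 - q < n + 1)) (R := R) (by positivity)
  refine ⟨fun j => u (j + (2 * n + 1 + 2 * R)) * (K * ((n : ℝ) + 1) ^ ((2 * R + 1 + 2 * n : ℝ))),
    ((summable_nat_add_iff _).2 hu).mul_right _, fun s hs j => ?_⟩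
  have hre : -(R : ℝ) ≤ s.re := by
    have := (abs_le.1 ((Complex.abs_re_le_norm s).trans hs)).1
    exact this
  generalize hi : j + (2 * n + 1 + 2 * R) = i
  have hi' : (2 * n + 1 + 2 * R : ℝ) ≤ i := by exact_mod_cast (by omega : 2 * n + 1 + 2 * R ≤ i)
  have hw : (2 * s + i - 1 : ℂ).re = 2 * s.re + i - 1 := by simp
  have h1 := hxi (2 * s + i - 1) (by rw [hw]; linarith)
  rw [hw] at h1
  have h2 : ((n : ℝ) + 1) ^ (-(2 * s.re + i - 1 - 2 * n)) ≤
      ((n : ℝ) + 1)⁻¹ ^ i * ((n : ℝ) + 1) ^ ((2 * R + 1 + 2 * n : ℝ)) := by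
    rw [inv_pow, ← Real.rpow_natCast, ← Real.rpow_neg hn1.le, ← Real.rpow_add hn1]
    apply Real.rpow_le_rpow_of_exponent_le
    · have : (0 : ℝ) ≤ n := Nat.cast_nonneg n
      linarith
    · linarith
  rw [zetaBarContTerm, norm_mul]
  calc _ ≤ ‖binomCoeff (n + 1 - q) s i‖ * (K * (((n : ℝ) + 1)⁻¹ ^ i *
        ((n : ℝ) + 1) ^ ((2 * R + 1 + 2 * n : ℝ)))) := by gcongr; exact h1.trans (by gcongr)
    _ = (‖binomCoeff (n + 1 - q) s i‖ * ((n : ℝ) + 1)⁻¹ ^ i) *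
        (K * ((n : ℝ) + 1) ^ ((2 * R + 1 + 2 * n : ℝ))) := by ring
    _ ≤ u i * (K * ((n : ℝ) + 1) ^ ((2 * R + 1 + 2 * n : ℝ))) :=
        mul_le_mul_of_nonneg_right (hb s hs i) (by positivity)
    _ = _ := by rw [← hi]

theorem analyticAt_binomCoeff (a j : ℕ) (s : ℂ) : AnalyticAt ℂ (fun s => binomCoeff a s j) s := by
  cases j with
  | zero => exact analyticAt_const
  | succ j =>
    simp only [binomCoeff]
    have : AnalyticAt ℂ (fun s : ℂ => ∏ i ∈ Finset.range j, (s + i)) s :=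
      Finset.analyticAt_fun_prod _ fun i _ => by fun_prop
    fun_prop

theorem meromorphicAt_zetaBarContTerm (n q j : ℕ) (s : ℂ) :
    MeromorphicAt (zetaBarContTerm n q j) s :=
  (analyticAt_binomCoeff _ j s).meromorphicAt.mul
    ((meromorphicAt_xiCont n q _).comp_analyticAt (g := fun s : ℂ => 2 * s + j - 1) (by fun_prop))

theorem analyticAt_zetaBarContTerm {j : ℕ} {s : ℂ}
    (h : AnalyticAt ℂ (xiCont n q) (2 * s + j - 1)) : AnalyticAt ℂ (zetaBarContTerm n q j) s :=
  (analyticAt_binomCoeff _ j s).mul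
    (h.comp_of_eq (f := fun s : ℂ => 2 * s + j - 1) (by fun_prop) rfl)

theorem zetaBarCont_eq_sum_add_tsum (hq : 1 ≤ q) (hqn : q ≤ n) {R : ℕ} {s : ℂ} (hs : ‖s‖ ≤ R) :
    zetaBarCont n q s = ∑ j ∈ Finset.range (2 * n + 1 + 2 * R), zetaBarContTerm n q j s +
      ∑' j, zetaBarContTerm n q (j + (2 * n + 1 + 2 * R)) s := by
  obtain ⟨u, hu, hb⟩ := exists_summable_zetaBarContTerm_bound hq hqn R
  exact (Summable.sum_add_tsum_nat_add' (Summable.of_norm_bounded hu (hb s hs))).symm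

theorem analyticAt_tsum_zetaBarContTerm (hq : 1 ≤ q) (hqn : q ≤ n) {R : ℕ} {s : ℂ}
    (hs : ‖s‖ < R) :
    AnalyticAt ℂ (fun s => ∑' j, zetaBarContTerm n q (j + (2 * n + 1 + 2 * R)) s) s := by
  obtain ⟨u, hu, hb⟩ := exists_summable_zetaBarContTerm_bound hq hqn R
  refine DifferentiableOn.analyticAt (s := Metric.ball 0 R) ?_
    (Metric.isOpen_ball.mem_nhds (by simpa using hs))
  refine Complex.differentiableOn_tsum_of_summable_norm hu (fun j z hz => ?_) Metric.isOpen_ball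
    fun j z hz => hb z (by simpa using (mem_ball_zero_iff.1 hz).le) j
  refine (analyticAt_zetaBarContTerm (analyticAt_xiCont_of_lt_re ?_)).differentiableAt.differentiableWithinAt
  have hre : -(R : ℝ) ≤ z.re :=
    (abs_le.1 ((Complex.abs_re_le_norm z).trans (mem_ball_zero_iff.1 hz).le)).1
  have : (0 : ℝ) ≤ j := Nat.cast_nonneg j
  simp
  linarith

theorem zetaBarCont_eventuallyEq (hq : 1 ≤ q) (hqn : q ≤ n) {R : ℕ} {s : ℂ} (hs : ‖s‖ < R) :
    zetaBarCont n q =ᶠ[𝓝 s] fun s =>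
      ∑ j ∈ Finset.range (2 * n + 1 + 2 * R), zetaBarContTerm n q j s +
        ∑' j, zetaBarContTerm n q (j + (2 * n + 1 + 2 * R)) s := by
  filter_upwards [Metric.isOpen_ball.mem_nhds (mem_ball_zero_iff.2 hs)] with z hz
  exact zetaBarCont_eq_sum_add_tsum hq hqn (mem_ball_zero_iff.1 hz).le

theorem meromorphicAt_zetaBarCont (hq : 1 ≤ q) (hqn : q ≤ n) (s : ℂ) :
    MeromorphicAt (zetaBarCont n q) s := by
  obtain ⟨R, hR⟩ := exists_nat_gt ‖s‖
  have h : MeromorphicAt (fun s =>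
      ∑ j ∈ Finset.range (2 * n + 1 + 2 * R), zetaBarContTerm n q j s +
        ∑' j, zetaBarContTerm n q (j + (2 * n + 1 + 2 * R)) s) s :=
    (MeromorphicAt.fun_sum fun j _ => meromorphicAt_zetaBarContTerm n q j s).add
      (analyticAt_tsum_zetaBarContTerm hq hqn hR).meromorphicAt
  exact h.congr ((zetaBarCont_eventuallyEq hq hqn hR).symm.filter_mono nhdsWithin_le_nhds)

theorem analyticAt_zetaBarCont (hq : 1 ≤ q) (hqn : q ≤ n) {s : ℂ} (hs : (n : ℝ) < s.re) :
    AnalyticAt ℂ (zetaBarCont n q) s := by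
  obtain ⟨R, hR⟩ := exists_nat_gt ‖s‖
  refine AnalyticAt.congr ?_ (zetaBarCont_eventuallyEq hq hqn hR).symm
  refine (Finset.analyticAt_fun_sum _ fun j _ => ?_).add
    (analyticAt_tsum_zetaBarContTerm hq hqn hR)
  refine analyticAt_zetaBarContTerm (analyticAt_xiCont_of_lt_re ?_)
  have : (0 : ℝ) ≤ j := Nat.cast_nonneg j
  simp
  linarith

/-! ### Agreement with the Dirichlet series for Re s > n -/

theorem d_eq_mul_α (hq : 1 ≤ q) (hqn : q ≤ n) {k : ℕ} (hk : q ≤ k) :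
    d n q k = ((k : ℚ) + ((k + n + 1 - q : ℕ) : ℚ)) * α n q k := by
  obtain ⟨r, rfl⟩ := Nat.exists_eq_add_of_le hk
  rw [d, α, if_pos hk, Nat.cast_add_choose, show q + r + n - q = r + n by omega,
    show q + r - q = r by omega, Nat.cast_add_choose]
  have p1 : ((q + r + n + 1 - q : ℕ) : ℚ) ≠ 0 := Nat.cast_ne_zero.2 (by omega)
  have p2 : ((q + r : ℕ) : ℚ) ≠ 0 := Nat.cast_ne_zero.2 (by omega)
  have f (m : ℕ) : (m.factorial : ℚ) ≠ 0 := Nat.cast_ne_zero.2 m.factorial_ne_zero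
  have f1 := f n
  have f2 := f (q - 1)
  have f3 := f (n - q)
  have f4 := f (q + r)
  have f5 := f r
  generalize ((q + r + n + 1 - q : ℕ) : ℚ) = x at *
  generalize ((q + r : ℕ) : ℚ) = y at *
  field_simp
  ring

theorem hasSum_zetaBarTerm_apply (hq : 1 ≤ q) (hqn : q ≤ n) (s : ℂ) (k : ℕ) :
    HasSum (fun j : ℕ => binomCoeff (n + 1 - q) s j *
      ((α n q k : ℂ) * ((k + n + 1 - q : ℕ) : ℂ) ^ (-(2 * s + j - 1)))) (zetaBarTerm n q s k) := by
  by_cases hk : q ≤ k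
  · have hx : (0 : ℝ) < ((k + n + 1 - q : ℕ) : ℝ) := Nat.cast_pos.2 (by omega)
    have hx0 : ((k + n + 1 - q : ℕ) : ℂ) ≠ 0 := Nat.cast_ne_zero.2 (by omega)
    have hkx : (((k + n + 1 - q : ℕ) : ℝ) - ((n + 1 - q : ℕ) : ℝ)) = k := by
      rw [sub_eq_iff_eq_add, ← Nat.cast_add]; congr 1; omega
    have hkx' : ((k + n + 1 - q : ℕ) : ℂ) - ((n + 1 - q : ℕ) : ℂ) = k := by exact_mod_cast hkx
    have ht : ‖((n + 1 - q : ℕ) : ℂ) * ((k + n + 1 - q : ℕ) : ℂ)⁻¹‖ < 1 := by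
      rw [norm_mul, norm_inv, Complex.norm_natCast, Complex.norm_natCast, ← div_eq_mul_inv,
        div_lt_one hx]
      exact_mod_cast (by omega : n + 1 - q < k + n + 1 - q)
    have h := (hasSum_binomCoeff (n + 1 - q) s ht).mul_right
      ((α n q k : ℂ) * ((k + n + 1 - q : ℕ) : ℂ) ^ (1 - 2 * s))
    have e : zetaBarTerm n q s k = (2 - ((n + 1 - q : ℕ) : ℂ) * ((k + n + 1 - q : ℕ) : ℂ)⁻¹) *
        (1 - ((n + 1 - q : ℕ) : ℂ) * ((k + n + 1 - q : ℕ) : ℂ)⁻¹) ^ (-s) *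
        ((α n q k : ℂ) * ((k + n + 1 - q : ℕ) : ℂ) ^ (1 - 2 * s)) := by
      simp only [zetaBarTerm, if_pos hk]
      rw [d_eq_mul_α hq hqn hk, Nat.cast_mul,
        Complex.natCast_mul_natCast_cpow, div_eq_mul_inv, mul_inv, ← Complex.cpow_neg,
        ← Complex.cpow_neg]
      have hk2 : (k : ℂ) ^ (-s) = ((k + n + 1 - q : ℕ) : ℂ) ^ (-s) *
          (1 - ((n + 1 - q : ℕ) : ℂ) * ((k + n + 1 - q : ℕ) : ℂ)⁻¹) ^ (-s) := by
        have h1 : (0 : ℝ) ≤ 1 - ((n + 1 - q : ℕ) : ℝ) * ((k + n + 1 - q : ℕ) : ℝ)⁻¹ := by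
          rw [sub_nonneg, ← div_eq_mul_inv, div_le_one hx]
          exact_mod_cast (by omega : n + 1 - q ≤ k + n + 1 - q)
        have h2 := Complex.mul_cpow_ofReal_nonneg hx.le h1 (-s)
        rw [← Complex.ofReal_mul, mul_sub, mul_one, mul_comm ((n + 1 - q : ℕ) : ℝ),
          mul_inv_cancel_left₀ hx.ne', hkx] at h2
        push_cast at h2
        rw [mul_comm ((n + 1 - q : ℕ) : ℂ)]
        exact h2
      rw [hk2, show (1 : ℂ) - 2 * s = 1 + (-s + -s) by ring, Complex.cpow_add _ _ hx0,
        Complex.cpow_add _ _ hx0, Complex.cpow_one]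
      have h3 : (((k : ℚ) + ((k + n + 1 - q : ℕ) : ℚ)) * α n q k : ℚ) =
          ((2 - ((n + 1 - q : ℕ) : ℂ) * ((k + n + 1 - q : ℕ) : ℂ)⁻¹) *
            ((k + n + 1 - q : ℕ) : ℂ)) * (α n q k : ℂ) := by
        push_cast
        congr 1
        rw [← hkx']
        field_simp
        ring
      rw [h3]
      ring
    rw [e]
    refine h.congr_fun fun j => ?_
    rw [show -(2 * s + j - 1) = -(j : ℂ) + (1 - 2 * s) by ring, Complex.cpow_add _ _ hx0,
      Complex.cpow_neg, Complex.cpow_natCast, inv_pow]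
    ring
  · have h0 : α n q k = 0 := by rw [α, if_neg hk]
    simp [h0, zetaBarTerm, hk]

/-- Fubini for the double series in (j, k). It is dominated by the product of the majorant of the
binomial coefficients and the absolutely convergent series of ξ at 2s-1. -/
theorem summable_zetaBarTerm_and_eq (hq : 1 ≤ q) (hqn : q ≤ n) {s : ℂ} (hs : (n : ℝ) < s.re) :
    Summable (zetaBarTerm n q s) ∧ zetaBarCont n q s = zetaBarSeries n q s := by
  have hn1 : (0 : ℝ) < n + 1 := by positivity
  have hre (j : ℕ) : (2 * n - 1 : ℝ) < (2 * s + j - 1 : ℂ).re := by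
    have : (0 : ℝ) ≤ j := Nat.cast_nonneg j
    simp
    linarith
  have hrow (j : ℕ) := (hasSum_xiCont hq hqn (hre j)).mul_left (binomCoeff (n + 1 - q) s j)
  obtain ⟨u, hu, hb⟩ := exists_summable_binomCoeff_bound (n + 1 - q) (ρ := ((n : ℝ) + 1)⁻¹)
    (by positivity) (by
      rw [← div_eq_mul_inv, div_lt_one hn1]
      exact_mod_cast (by omega : n + 1 - q < n + 1)) (norm_nonneg s)
  have hu0 : 0 ≤ u := fun j => le_trans (by positivity) (hb s le_rfl j)
  have hsum : Summable fun x : ℕ × ℕ => binomCoeff (n + 1 - q) s x.1 *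
      ((α n q x.2 : ℂ) * ((x.2 + n + 1 - q : ℕ) : ℂ) ^ (-(2 * s + x.1 - 1))) := by
    refine Summable.of_norm_bounded
      (hu.mul_of_nonneg (hasSum_xiCont hq hqn (hre 0)).summable.norm hu0
        fun _ => norm_nonneg _) fun x => ?_
    rw [norm_mul]
    have h1 := norm_α_mul_cpow_le (n := n) (q := q) (w := 2 * s + x.1 - 1) (z := 2 * s + (0 : ℕ) - 1)
      (by simp) x.2
    have h2 : -((2 * s + x.1 - 1 : ℂ).re - (2 * s + (0 : ℕ) - 1 : ℂ).re) = -(x.1 : ℝ) := by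
      simp
    rw [h2, Real.rpow_neg hn1.le, Real.rpow_natCast, ← inv_pow] at h1
    refine (mul_le_mul_of_nonneg_left h1 (norm_nonneg _)).trans ?_
    rw [mul_comm ‖_‖ (_ ^ x.1), ← mul_assoc]
    gcongr
    exact hb s le_rfl x.1
  have hA := hsum.hasSum.prod_fiberwise hrow
  have hB := (hsum.prod_symm.hasSum).prod_fiberwise (hasSum_zetaBarTerm_apply hq hqn s)
  refine ⟨hB.summable, ?_⟩
  rw [zetaBarCont, zetaBarSeries, hB.tsum_eq]
  refine hA.tsum_eq.trans ?_
  exact ((Equiv.prodComm ℕ ℕ).tsum_eq _).symm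

/-! ### Limits at the non-positive integers -/

theorem prod_range_neg_nat_add (m j : ℕ) :
    ∏ i ∈ Finset.range j, (-(m : ℂ) + i) = (-1) ^ j * (j.factorial : ℂ) * (m.choose j : ℂ) := by
  rw [mul_assoc, ← Nat.cast_mul, ← Nat.descFactorial_eq_factorial_mul_choose,
    ← descPochhammer_eval_eq_descFactorial, descPochhammer_eval_eq_prod_range,
    ← Finset.card_range j, ← Finset.prod_const, Finset.card_range, ← Finset.prod_mul_distrib]
  exact Finset.prod_congr rfl fun i _ => by ring

theorem binomCoeff_neg_nat (a m j : ℕ) :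
    binomCoeff a (-(m : ℂ)) j =
      (-1 : ℂ) ^ j * ((2 * (m : ℂ) + 2 - j) / ((m : ℂ) + 1)) * ((m + 1).choose j : ℂ) *
        (a : ℂ) ^ j := by
  have hm : (m : ℂ) + 1 ≠ 0 := Nat.cast_add_one_ne_zero m
  cases j with
  | zero => simp [binomCoeff]; field_simp
  | succ j =>
    have h1 : (j.factorial : ℂ) ≠ 0 := Nat.cast_ne_zero.2 j.factorial_ne_zero
    have h3 : (j : ℂ) + 1 ≠ 0 := Nat.cast_add_one_ne_zero j
    have hc : ((m : ℂ) + 1) * (m.choose j : ℂ) = ((m + 1).choose (j + 1) : ℂ) * (j + 1) := by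
      exact_mod_cast Nat.add_one_mul_choose_eq m j
    rw [eq_comm, ← eq_div_iff h3] at hc
    rw [binomCoeff, prod_range_neg_nat_add, hc, Nat.factorial_succ]
    push_cast
    field_simp
    ring

theorem tendsto_zetaBarContTerm_of_analyticAt {m j : ℕ}
    (h : AnalyticAt ℂ (xiCont n q) (-2 * (m : ℂ) + j - 1)) :
    Tendsto (zetaBarContTerm n q j) (𝓝[≠] (-(m : ℂ)))
      (𝓝 ((-1 : ℂ) ^ j * ((2 * (m : ℂ) + 2 - j) / ((m : ℂ) + 1)) * ((m + 1).choose j : ℂ) *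
        ((n + 1 - q : ℕ) : ℂ) ^ j * xiCont n q (-2 * (m : ℂ) + j - 1))) := by
  rw [← binomCoeff_neg_nat]
  have e : 2 * -(m : ℂ) + j - 1 = -2 * (m : ℂ) + j - 1 := by ring
  have h2 := (analyticAt_zetaBarContTerm (s := -(m : ℂ)) (by rwa [e])).continuousAt
  have h3 := h2.tendsto.mono_left (nhdsWithin_le_nhds (s := {-(m : ℂ)}ᶜ))
  rwa [zetaBarContTerm, e] at h3

/-- The factor s+m of the coefficient meets a possible simple pole of ξ(2s+j-1). As 2s+j-1-l =
2(s+m), the limit is half the residue times the remaining factors. -/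
theorem tendsto_zetaBarContTerm_of_mem_Icc {m j : ℕ}
    (hj : j ∈ Finset.Icc (2 * m + 2) (2 * n + 2 * m)) :
    Tendsto (zetaBarContTerm n q j) (𝓝[≠] (-(m : ℂ)))
      (𝓝 ((-1 : ℂ) ^ m * ((m.factorial : ℂ) / 2) * (((n + 1 - q : ℕ) : ℂ) ^ j *
        (Complex.Gamma (-(m : ℂ) + j - 1) * (-2 * (m : ℂ) - 2 + j) / Complex.Gamma ((j : ℂ) + 1)) *
        (γ n q (j - (2 * m + 1)) : ℂ)))) := by
  rw [Finset.mem_Icc] at hj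
  -- The product over i < j-1 = m+1+r splits into m factors tending to (-1)^m m!, the vanishing
  -- factor s+m, and r factors tending to r! = Γ(-m+j-1).
  obtain ⟨r, rfl⟩ : ∃ r, j = m + 1 + r + 1 := ⟨j - (m + 2), by omega⟩
  set l := m + 1 + r + 1 - (2 * m + 1) with hl
  have hlc : (l : ℂ) = (r : ℂ) + 1 - m := by
    have : ((l + m : ℕ) : ℂ) = ((r + 1 : ℕ) : ℂ) := by congr 1; omega
    push_cast at this
    rw [← this]; ring
  have hres := tendsto_sub_mul_xiCont (n := n) (q := q) (l := l) (by rw [Finset.mem_Icc]; omega)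
  have hw : Tendsto (fun s : ℂ => 2 * s + ((m + 1 + r + 1 : ℕ) : ℂ) - 1) (𝓝[≠] (-(m : ℂ)))
      (𝓝[≠] (l : ℂ)) := by
    refine tendsto_nhdsWithin_iff.2 ⟨?_, ?_⟩
    · have : ContinuousAt (fun s : ℂ => 2 * s + ((m + 1 + r + 1 : ℕ) : ℂ) - 1) (-(m : ℂ)) := by
        fun_prop
      have h := this.tendsto.mono_left (nhdsWithin_le_nhds (s := {-(m : ℂ)}ᶜ))
      convert h using 2
      rw [hlc]; push_cast; ring
    · filter_upwards [self_mem_nhdsWithin] with s hs h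
      apply hs
      rw [Set.mem_singleton_iff, hlc] at h
      push_cast at h
      rw [Set.mem_singleton_iff]
      linear_combination h / 2
  have h1 := hres.comp hw
  have hP : ContinuousAt (fun s : ℂ => ((n + 1 - q : ℕ) : ℂ) ^ (m + 1 + r + 1) /
      ((m + 1 + r + 1).factorial : ℂ) * ((∏ i ∈ Finset.range m, (s + i)) *
        ∏ i ∈ Finset.range r, (s + ((m + 1 + i : ℕ) : ℂ))) *
        (2 * s + ((m + 1 + r : ℕ) : ℂ) - 1) / 2) (-(m : ℂ)) := by
    fun_prop
  have h2 := (hP.tendsto.mono_left (nhdsWithin_le_nhds (s := {-(m : ℂ)}ᶜ))).mul h1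
  have hprod : ∏ i ∈ Finset.range r, (-(m : ℂ) + ((m + 1 + i : ℕ) : ℂ)) = (r.factorial : ℂ) := by
    rw [← Finset.prod_range_add_one_eq_factorial]
    push_cast
    exact Finset.prod_congr rfl fun i _ => by ring
  rw [hprod, prod_range_neg_nat_add, Nat.choose_self] at h2
  have hg1 : Complex.Gamma (-(m : ℂ) + ((m + 1 + r + 1 : ℕ) : ℂ) - 1) = (r.factorial : ℂ) := by
    rw [← Complex.Gamma_nat_eq_factorial]
    congr 1; push_cast; ring
  rw [hg1, Complex.Gamma_nat_eq_factorial]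
  convert h2 using 2
  · simp only [Function.comp, zetaBarContTerm, binomCoeff, Finset.prod_range_add _ (m + 1) r,
      Finset.prod_range_succ _ m, hlc]
    push_cast
    ring
  · push_cast
    ring

theorem tendsto_zetaBarCont_neg_nat (hq : 1 ≤ q) (hqn : q ≤ n) (m : ℕ) :
    Tendsto (zetaBarCont n q) (𝓝[≠] (-(m : ℂ)))
      (𝓝 (∑ j ∈ Finset.range (2 * m + 2),
            (-1 : ℂ) ^ j * ((2 * (m : ℂ) + 2 - j) / ((m : ℂ) + 1)) * ((m + 1).choose j : ℂ) *
              ((n + 1 - q : ℕ) : ℂ) ^ j * xiCont n q (-2 * (m : ℂ) + j - 1) +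
          (-1 : ℂ) ^ m * ((m.factorial : ℂ) / 2) *
            ∑ j ∈ Finset.Icc (2 * m + 2) (2 * n + 2 * m),
              ((n + 1 - q : ℕ) : ℂ) ^ j *
                (Complex.Gamma (-(m : ℂ) + j - 1) * (-2 * (m : ℂ) - 2 + j) /
                  Complex.Gamma ((j : ℂ) + 1)) *
                (γ n q (j - (2 * m + 1)) : ℂ))) := by
  -- The radius m+1 puts -m inside the disc of uniform convergence. The cut at 2n+1+2(m+1) lies
  -- beyond the last pole index 2n+2m; the indices between have zero coefficient and analytic ξ.
  have hR : ‖(-(m : ℂ))‖ < (m + 1 : ℕ) := by simp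
  have hz (j : ℕ) (hj : m + 2 ≤ j) : binomCoeff (n + 1 - q) (-(m : ℂ)) j = 0 := by
    rw [binomCoeff_neg_nat, Nat.choose_eq_zero_of_lt (by omega)]; simp
  have htail := (analyticAt_tsum_zetaBarContTerm hq hqn hR).continuousAt.tendsto.mono_left
    (nhdsWithin_le_nhds (s := {-(m : ℂ)}ᶜ))
  have htail0 : ∑' j, zetaBarContTerm n q (j + (2 * n + 1 + 2 * (m + 1))) (-(m : ℂ)) = 0 := by
    refine (tsum_congr fun j => ?_).trans tsum_zero
    rw [zetaBarContTerm, hz _ (by omega), zero_mul]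
  rw [htail0] at htail
  have hlow : Tendsto (fun s => ∑ j ∈ Finset.range (2 * m + 2), zetaBarContTerm n q j s)
      (𝓝[≠] (-(m : ℂ))) (𝓝 (∑ j ∈ Finset.range (2 * m + 2),
            (-1 : ℂ) ^ j * ((2 * (m : ℂ) + 2 - j) / ((m : ℂ) + 1)) * ((m + 1).choose j : ℂ) *
              ((n + 1 - q : ℕ) : ℂ) ^ j * xiCont n q (-2 * (m : ℂ) + j - 1))) := by
    refine tendsto_finsetSum _ fun j hj => tendsto_zetaBarContTerm_of_analyticAt ?_
    rw [Finset.mem_range] at hj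
    have := analyticAt_xiCont_neg_nat (n := n) (q := q) (2 * m + 1 - j)
    rwa [Nat.cast_sub (by omega), show -(((2 * m + 1 : ℕ) : ℂ) - j) = -2 * (m : ℂ) + j - 1 by
      push_cast; ring] at this
  have hmid : Tendsto (fun s => ∑ j ∈ Finset.Icc (2 * m + 2) (2 * n + 2 * m),
      zetaBarContTerm n q j s) (𝓝[≠] (-(m : ℂ))) (𝓝 ((-1 : ℂ) ^ m * ((m.factorial : ℂ) / 2) *
            ∑ j ∈ Finset.Icc (2 * m + 2) (2 * n + 2 * m),
              ((n + 1 - q : ℕ) : ℂ) ^ j *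
                (Complex.Gamma (-(m : ℂ) + j - 1) * (-2 * (m : ℂ) - 2 + j) /
                  Complex.Gamma ((j : ℂ) + 1)) *
                (γ n q (j - (2 * m + 1)) : ℂ))) := by
    rw [Finset.mul_sum]
    exact tendsto_finsetSum _ fun j hj => tendsto_zetaBarContTerm_of_mem_Icc hj
  have hhigh : Tendsto (fun s => ∑ j ∈ Finset.Ioo (2 * n + 2 * m) (2 * n + 1 + 2 * (m + 1)),
      zetaBarContTerm n q j s) (𝓝[≠] (-(m : ℂ))) (𝓝 0) := by
    rw [← Finset.sum_const_zero (s := Finset.Ioo (2 * n + 2 * m) (2 * n + 1 + 2 * (m + 1)))]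
    refine tendsto_finsetSum _ fun j hj => ?_
    rw [Finset.mem_Ioo] at hj
    have hj' : (2 * n + 2 * m + 1 : ℝ) ≤ j := by exact_mod_cast (by omega : 2 * n + 2 * m + 1 ≤ j)
    have h := tendsto_zetaBarContTerm_of_analyticAt (n := n) (q := q) (m := m) (j := j)
      (analyticAt_xiCont_of_lt_re (by simp; linarith))
    rwa [← binomCoeff_neg_nat, hz _ (by omega), zero_mul] at h
  have hall := (((hlow.add hmid).add hhigh).add htail)
  rw [add_zero, add_zero] at hall
  refine hall.congr' ?_
  filter_upwards [(zetaBarCont_eventuallyEq hq hqn hR).filter_mono nhdsWithin_le_nhds] with s hs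
  rw [hs]
  congr 1
  have hd1 : Disjoint (Finset.range (2 * m + 2)) (Finset.Icc (2 * m + 2) (2 * n + 2 * m)) := by
    rw [Finset.disjoint_left]; intro x; simp; omega
  have hd2 : Disjoint (Finset.range (2 * m + 2) ∪ Finset.Icc (2 * m + 2) (2 * n + 2 * m))
      (Finset.Ioo (2 * n + 2 * m) (2 * n + 1 + 2 * (m + 1))) := by
    rw [Finset.disjoint_left]; intro x; simp; omega
  rw [← Finset.sum_union hd1, ← Finset.sum_union hd2]
  congr 1
  ext x
  simp
  omega

theorem exists_rat_xiCont_neg_nat (hqn : q ≤ n) (l : ℕ) :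
    ∃ r : ℚ, xiCont n q (-(l : ℂ)) = (r : ℂ) := by
  rw [xiCont_neg_nat hqn]
  exact ⟨-∑ i ∈ Finset.range (2 * n - 1), b n i * ∑ p ∈ Finset.range (i + 1), (i.choose p : ℚ) *
    (β n q l i p / ((p : ℚ) + l + 1)), by push_cast; rfl⟩

theorem exists_rat_tendsto_zetaBarCont_neg_nat (hq : 1 ≤ q) (hqn : q ≤ n) (m : ℕ) :
    ∃ r : ℚ, Tendsto (zetaBarCont n q) (𝓝[≠] (-(m : ℂ))) (𝓝 (r : ℂ)) := by
  choose x hx using exists_rat_xiCont_neg_nat (n := n) (q := q) hqn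
  refine ⟨∑ j ∈ Finset.range (2 * m + 2),
            (-1 : ℚ) ^ j * ((2 * (m : ℚ) + 2 - j) / ((m : ℚ) + 1)) * ((m + 1).choose j : ℚ) *
              ((n + 1 - q : ℕ) : ℚ) ^ j * x (2 * m + 1 - j) +
          (-1 : ℚ) ^ m * ((m.factorial : ℚ) / 2) *
            ∑ j ∈ Finset.Icc (2 * m + 2) (2 * n + 2 * m),
              ((n + 1 - q : ℕ) : ℚ) ^ j *
                (((j - (m + 2)).factorial : ℚ) * (-2 * (m : ℚ) - 2 + j) / (j.factorial : ℚ)) *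
                γ n q (j - (2 * m + 1)), ?_⟩
  convert tendsto_zetaBarCont_neg_nat hq hqn m using 2
  push_cast
  congr 1
  · refine Finset.sum_congr rfl fun j hj => ?_
    rw [Finset.mem_range] at hj
    rw [← hx, Nat.cast_sub (by omega : j ≤ 2 * m + 1), show -(((2 * m + 1 : ℕ) : ℂ) - j) = -2 * (m : ℂ) + j - 1 by
      push_cast; ring]
  · congr 1
    refine Finset.sum_congr rfl fun j hj => ?_
    rw [Finset.mem_Icc] at hj
    -- Here j ≥ 2m+2 ≥ m+2, so Γ(-m+j-1) is the factorial of j-m-2 and hence rational.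
    rw [Complex.Gamma_nat_eq_factorial, ← Complex.Gamma_nat_eq_factorial (j - (m + 2)),
      Nat.cast_sub (by omega : m + 2 ≤ j), show (j : ℂ) - ((m + 2 : ℕ) : ℂ) + 1 = -(m : ℂ) + j - 1 by
      push_cast; ring]

/-! ### The spectral zeta function and the main theorem -/

/-- The meromorphic continuation of `zetaSeries n q`. -/
noncomputable def zetaCont (n q : ℕ) (s : ℂ) : ℂ :=
  if q < n then zetaBarCont n q s + zetaBarCont n (q + 1) s else zetaBarCont n q s

theorem meromorphicAt_zetaCont (hq : 1 ≤ q) (hqn : q ≤ n) (s : ℂ) :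
    MeromorphicAt (zetaCont n q) s := by
  unfold zetaCont
  split_ifs with h
  · exact (meromorphicAt_zetaBarCont hq hqn s).add (meromorphicAt_zetaBarCont (by omega) h s)
  · exact meromorphicAt_zetaBarCont hq hqn s

theorem analyticAt_zetaCont (hq : 1 ≤ q) (hqn : q ≤ n) {s : ℂ} (hs : (n : ℝ) < s.re) :
    AnalyticAt ℂ (zetaCont n q) s := by
  unfold zetaCont
  split_ifs with h
  · exact (analyticAt_zetaBarCont hq hqn hs).add (analyticAt_zetaBarCont (by omega) h hs)
  · exact analyticAt_zetaBarCont hq hqn hs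

theorem zetaCont_eq_zetaSeries (hq : 1 ≤ q) (hqn : q ≤ n) {s : ℂ} (hs : (n : ℝ) < s.re) :
    zetaCont n q s = zetaSeries n q s := by
  unfold zetaCont zetaSeries
  split_ifs with h
  · rw [(summable_zetaBarTerm_and_eq hq hqn hs).2,
      (summable_zetaBarTerm_and_eq (q := q + 1) (by omega) h hs).2]
  · exact (summable_zetaBarTerm_and_eq hq hqn hs).2

theorem exists_rat_tendsto_zetaCont_neg_nat (hq : 1 ≤ q) (hqn : q ≤ n) (m : ℕ) :
    ∃ r : ℚ, Tendsto (zetaCont n q) (𝓝[≠] (-(m : ℂ))) (𝓝 (r : ℂ)) := by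
  obtain ⟨r, hr⟩ := exists_rat_tendsto_zetaBarCont_neg_nat hq hqn m
  unfold zetaCont
  split_ifs with h
  · obtain ⟨r', hr'⟩ := exists_rat_tendsto_zetaBarCont_neg_nat (q := q + 1) (by omega) h m
    exact ⟨r + r', by push_cast; exact hr.add hr'⟩
  · exact ⟨r, hr⟩

end FubiniStudyZeta

theorem mainTheorem1 (n q : ℕ) (hq : 1 ≤ q) (hqn : q ≤ n) :
    -- all the defining series and integrals converge
    (∀ s : ℂ, (n : ℝ) < s.re → Summable (FubiniStudyZeta.zetaBarTerm n q s)) ∧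
    (∀ z : ℂ, ‖z‖ < 1 → Summable fun k : ℕ => (FubiniStudyZeta.α n q k : ℂ) * z ^ k) ∧
    (∀ s : ℂ, (2 * n - 1 : ℝ) < s.re → MellinConvergent (FubiniStudyZeta.xiKernel n q) s) ∧
    -- the meromorphic continuations exist
    (∃ ξ : ℂ → ℂ, FubiniStudyZeta.IsMeromorphicContinuation (2 * n - 1)
      (FubiniStudyZeta.xiIntegral n q) ξ) ∧
    (∃ Zbar : ℂ → ℂ, FubiniStudyZeta.IsMeromorphicContinuation n
      (FubiniStudyZeta.zetaBarSeries n q) Zbar) ∧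
    (∃ Z : ℂ → ℂ, FubiniStudyZeta.IsMeromorphicContinuation n
      (FubiniStudyZeta.zetaSeries n q) Z) ∧
    -- their values
    ∀ ξ Zbar Z : ℂ → ℂ,
      FubiniStudyZeta.IsMeromorphicContinuation (2 * n - 1)
        (FubiniStudyZeta.xiIntegral n q) ξ →
      FubiniStudyZeta.IsMeromorphicContinuation n (FubiniStudyZeta.zetaBarSeries n q) Zbar →
      FubiniStudyZeta.IsMeromorphicContinuation n (FubiniStudyZeta.zetaSeries n q) Z →
      -- `ξ` has at most simple poles, all in `{1, …, 2n-1}`, with residues `γ`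
      (∀ s : ℂ, (∀ l ∈ Finset.Icc 1 (2 * n - 1), s ≠ (l : ℂ)) → AnalyticAt ℂ ξ s) ∧
      (∀ l ∈ Finset.Icc 1 (2 * n - 1),
        Tendsto (fun s : ℂ => (s - l) * ξ s) (𝓝[≠] (l : ℂ))
          (𝓝 (FubiniStudyZeta.γ n q l : ℂ))) ∧
      -- the values of `ξ` at non-positive integers
      (∀ l : ℕ, ξ (-(l : ℂ)) =
        -∑ i ∈ Finset.range (2 * n - 1), (FubiniStudyZeta.b n i : ℂ) *
          ∑ p ∈ Finset.range (i + 1), (i.choose p : ℂ) *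
            ((FubiniStudyZeta.β n q l i p : ℂ) / ((p : ℂ) + l + 1))) ∧
      -- the values of the zeta functions at non-positive integers
      ∀ m : ℕ,
        AnalyticAt ℂ Zbar (-(m : ℂ)) ∧
        Zbar (-(m : ℂ)) =
          ∑ j ∈ Finset.range (2 * m + 2),
            (-1 : ℂ) ^ j * ((2 * (m : ℂ) + 2 - j) / ((m : ℂ) + 1)) * ((m + 1).choose j : ℂ) *
              ((n : ℂ) + 1 - q) ^ j * ξ (-2 * (m : ℂ) + j - 1) +
          (-1 : ℂ) ^ m * ((m.factorial : ℂ) / 2) *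
            ∑ j ∈ Finset.Icc (2 * m + 2) (2 * n + 2 * m),
              ((n : ℂ) + 1 - q) ^ j *
                (Complex.Gamma (-(m : ℂ) + j - 1) * (-2 * (m : ℂ) - 2 + j) /
                  Complex.Gamma ((j : ℂ) + 1)) *
                (FubiniStudyZeta.γ n q (j - (2 * m + 1)) : ℂ) ∧
        (∃ r : ℚ, Zbar (-(m : ℂ)) = (r : ℂ)) ∧
        AnalyticAt ℂ Z (-(m : ℂ)) ∧
        (∃ r : ℚ, Z (-(m : ℂ)) = (r : ℂ)) := by
  have hC : ((n + 1 - q : ℕ) : ℂ) = (n : ℂ) + 1 - q := by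
    rw [Nat.cast_sub (by omega)]; push_cast; rfl
  have hxiM := FubiniStudyZeta.meromorphicAt_xiCont n q
  have hxiE : ∀ s : ℂ, (2 * n - 1 : ℝ) < s.re → FubiniStudyZeta.xiCont n q s =
    FubiniStudyZeta.xiIntegral n q s := fun s => FubiniStudyZeta.xiCont_eq_xiIntegral hq hqn
  have hbM := FubiniStudyZeta.meromorphicAt_zetaBarCont hq hqn
  have hbE : ∀ s : ℂ, (n : ℝ) < s.re → FubiniStudyZeta.zetaBarCont n q s =
    FubiniStudyZeta.zetaBarSeries n q s :=
    fun s hs => (FubiniStudyZeta.summable_zetaBarTerm_and_eq hq hqn hs).2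
  have hzM := FubiniStudyZeta.meromorphicAt_zetaCont hq hqn
  have hzE : ∀ s : ℂ, (n : ℝ) < s.re → FubiniStudyZeta.zetaCont n q s =
    FubiniStudyZeta.zetaSeries n q s := fun s => FubiniStudyZeta.zetaCont_eq_zetaSeries hq hqn
  refine ⟨fun s hs => (FubiniStudyZeta.summable_zetaBarTerm_and_eq hq hqn hs).1,
    fun z hz => FubiniStudyZeta.summable_α_mul_pow hq hqn hz,
    fun s hs => FubiniStudyZeta.mellinConvergent_xiKernel hq hqn hs,
    ⟨_, FubiniStudyZeta.isMeromorphicContinuation_toMeromorphicNFOn hxiM hxiE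
      fun s => FubiniStudyZeta.analyticAt_xiCont_of_lt_re⟩,
    ⟨_, FubiniStudyZeta.isMeromorphicContinuation_toMeromorphicNFOn hbM hbE
      fun s => FubiniStudyZeta.analyticAt_zetaBarCont hq hqn⟩,
    ⟨_, FubiniStudyZeta.isMeromorphicContinuation_toMeromorphicNFOn hzM hzE
      fun s => FubiniStudyZeta.analyticAt_zetaCont hq hqn⟩, ?_⟩
  intro ξ Zbar Z hξ hZbar hZ
  -- Normal form makes ξ equal to `xiCont` pointwise, not only on punctured neighbourhoods, wherever
  -- `xiCont` is analytic.
  have hval {s : ℂ} (h : AnalyticAt ℂ (FubiniStudyZeta.xiCont n q) s) :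
      AnalyticAt ℂ ξ s ∧ ξ s = FubiniStudyZeta.xiCont n q s :=
    hξ.analyticAt_and_eq hxiM hxiE (h.continuousAt.tendsto.mono_left nhdsWithin_le_nhds)
  refine ⟨fun s hs => (hval (FubiniStudyZeta.analyticAt_xiCont hs)).1, fun l hl => ?_,
    fun l => ?_, fun m => ?_⟩
  · refine (FubiniStudyZeta.tendsto_sub_mul_xiCont hl).congr' ?_
    filter_upwards [hξ.eventuallyEq hxiM hxiE l] with s hs
    rw [hs]
  · rw [(hval (FubiniStudyZeta.analyticAt_xiCont_neg_nat l)).2, FubiniStudyZeta.xiCont_neg_nat hqn]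
  · obtain ⟨hA, hV⟩ := hZbar.analyticAt_and_eq hbM hbE
      (FubiniStudyZeta.tendsto_zetaBarCont_neg_nat hq hqn m)
    obtain ⟨r, hr⟩ := FubiniStudyZeta.exists_rat_tendsto_zetaBarCont_neg_nat hq hqn m
    obtain ⟨r', hr'⟩ := FubiniStudyZeta.exists_rat_tendsto_zetaCont_neg_nat hq hqn m
    obtain ⟨hA', hV'⟩ := hZ.analyticAt_and_eq hzM hzE hr'
    refine ⟨hA, ?_, ⟨r, (hZbar.analyticAt_and_eq hbM hbE hr).2⟩, hA', ⟨r', hV'⟩⟩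
    rw [hV, hC]
    congr 1
    refine Finset.sum_congr rfl fun j hj => ?_
    rw [Finset.mem_range] at hj
    have := (hval (FubiniStudyZeta.analyticAt_xiCont_neg_nat (2 * m + 1 - j))).2
    rw [Nat.cast_sub (by omega), show -(((2 * m + 1 : ℕ) : ℂ) - j) = -2 * (m : ℂ) + j - 1 by
      push_cast; ring] at this
    rw [this]
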